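/- Let $X$ be a non-empty countable set, let $b\colon X\times X\to[0,\infty)$ satisfy $b(x,y)=b(y,x)$, $b(x,x)=0$ and $\sum_{z\in X}b(x,z)<\infty$ for all $x,y\in X$, and let $\mu\colon X\to(0,\infty)$. Assume that the weighted graph $(X,b,\mu)$ is connected, i.e. every two vertices are joined by a finite path $x_0,\dots,x_n$ with $b(x_j,x_{j+1})>0$, and that it satisfies the finiteness condition (FC): for every $x\in X$ the function $y\mapsto b(x,y)/\mu(y)$ belongs to the Hilbert space $\ell^2(X,\mu)$ of functions $f\colon X\to\mathbb{C}$ with $\sum_{x}\mu(x)|f(x)|^2<\infty$, with inner product $(f,g)=\sum_x\mu(x)f(x)\overline{g(x)}$. For $V\colon X\to\mathbb{R}$ let $\mathcal{L}_V$ be the operator in $\ell^2(X,\mu)$ whose domain is the space $C_c(X)$ of finitely supported functions and which acts by $$\mathcal{L}_Vf(x)=\frac1{\mu(x)}\sum_{y\in X}b(x,y)\,(f(x)-f(y))+V(x)f(x);$$ by (FC) it maps into $\ell^2(X,\mu)$, and it is symmetric. If $\mathcal{L}_V$ is lower semi-bounded, i.e. $(\mathcal{L}_Vu,u)\ge C\|u\|^2$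 for some $C\in\mathbb{R}$ and all $u\in C_c(X)$, then the form $u\mapsto(\mathcal{L}_Vu,u)$ on $C_c(X)$ is closable; let $h_V$ be its closure, and let the Friedrichs extension $L_V$ of $\mathcal{L}_V$ be the operator associated with the closed form $h_V$. (The operator $T$ associated with a densely defined, closed, lower semi-bounded form $t$ is given by: $Tu=f$ if and only if $u\in D(t)$ and $t(u,v)=(f,v)$ for all $v\in D(t)$.) Let $V_1,V_2\colon X\to\mathbb{R}$ with $V_2(x)\ge0$ for all $x\in X$, and assume that $\mathcal{L}_{V_1}$ is lower semi-bounded; then so is $\mathcal{L}_{V_1+V_2}$. Let $M_{V_2}u=V_2u$ be the maximal multiplication operator, with domain $\{u\in\ell^2(X,\mu): V_2u\in\ell^2(X,\mu)\}$; it is the operator associated with the closed form $q_{V_2}(u)=\sum_x\mu(x)V_2(x)|u(x)|^2$ with domain $\{u\in\ell^2(X,\mu):\sum_x\mu(x)V_2(x)|u(x)|^2<\infty\}$. Let the form-sum $L_{V_1}\widetilde{+}M_{V_2}$ be the operator associated with the closed form $h_{V_1}+q_{V_2}$ with domain $D(h_{V_1})\cap D(q_{V_2})$. Then $$L_{V_1}\widetilde{+}M_{V_2}=L_{V_1+V_2}.$$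 -/

import Mathlib

noncomputable section

open Filter Topology ComplexConjugate

/-! ### Lower semi-bounded Hermitian forms in a complex inner product space

Inner products and sesquilinear forms are conjugate-linear in the first variable
and linear in the second one. -/

/-- A lower semi-bounded Hermitian sesquilinear form in `H`. -/
structure SemiboundedForm (H : Type*) [NormedAddCommGroup H] [InnerProductSpace ℂ H] where
  domain : Submodule ℂ H
  form : domain →ₗ⋆[ℂ] domain →ₗ[ℂ] ℂ
  hermitian : ∀ u v, conj (form u v) = form v u
  lower_bound : ∃ c : ℝ, ∀ u : domain, c * ‖(u : H)‖ ^ 2 ≤ (form u u).re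

namespace SemiboundedForm

variable {H : Type*} [NormedAddCommGroup H] [InnerProductSpace ℂ H] (t : SemiboundedForm H)

/-- The quadratic form `u ↦ t(u, u)`. -/
def quad (u : t.domain) : ℝ := (t.form u u).re

/-- `u n ∈ D(t)` is `t`-convergent to `x ∈ H`: `u n → x` in `H` and
`t(u n - u m) → 0` as `n, m → ∞`. -/
def ConvergesTo (u : ℕ → t.domain) (x : H) : Prop :=
  Tendsto (fun n => (u n : H)) atTop (𝓝 x) ∧
    Tendsto (fun p : ℕ × ℕ => t.quad (u p.1 - u p.2)) atTop (𝓝 0)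

/-- The form `t` is closable: `t`-convergence of `u n` to `0` implies `t(u n) → 0`. -/
def IsClosable : Prop :=
  ∀ u : ℕ → t.domain, t.ConvergesTo u 0 → Tendsto (fun n => t.quad (u n)) atTop (𝓝 0)

/-- The form `t` is closed: if `u n` is `t`-convergent to `x`, then `x ∈ D(t)` and
`t(u n - x) → 0`. -/
def IsClosed : Prop :=
  ∀ (u : ℕ → t.domain) (x : H), t.ConvergesTo u x →
    ∃ hx : x ∈ t.domain, Tendsto (fun n => t.quad (u n - ⟨x, hx⟩)) atTop (𝓝 0)

/-- Some lower bound of `t`. -/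
def bound : ℝ := t.lower_bound.choose

/-- The domain of `t`, to be equipped with the form norm. -/
def FormSpace : Type _ := t.domain

instance : AddCommGroup t.FormSpace := inferInstanceAs (AddCommGroup t.domain)

instance : Module ℂ t.FormSpace := inferInstanceAs (Module ℂ t.domain)

/-- The identity, as a map from `D(t)` to `D(t)` with the form norm. -/
def toFS : t.domain ≃ₗ[ℂ] t.FormSpace := LinearEquiv.refl ℂ t.domain

/-- The inner product `t(u, v) + (1 - c) (u, v)` of the form norm, `c` a lower bound of `t`. -/
@[reducible]
def formCore : PreInnerProductSpace.Core ℂ t.FormSpace where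
  inner u v := t.form (t.toFS.symm u) (t.toFS.symm v) +
    ((1 - t.bound : ℝ) : ℂ) * inner ℂ (t.toFS.symm u : H) (t.toFS.symm v : H)
  conj_inner_symm u v := by
    simp only [map_add, map_mul, Complex.conj_ofReal, inner_conj_symm, t.hermitian]
  re_inner_nonneg u := by
    have h := t.lower_bound.choose_spec (t.toFS.symm u)
    have h2 : (inner ℂ (t.toFS.symm u : H) (t.toFS.symm u : H) : ℂ) =
        ((‖(t.toFS.symm u : H)‖ ^ 2 : ℝ) : ℂ) := by
      rw [inner_self_eq_norm_sq_to_K]; push_cast; rfl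
    rw [h2, ← Complex.ofReal_mul]
    simp only [RCLike.re_to_complex, Complex.add_re, Complex.ofReal_re]
    change t.bound * _ ≤ _ at h
    nlinarith [sq_nonneg ‖(t.toFS.symm u : H)‖]
  add_left u v w := by
    simp only [map_add, LinearMap.add_apply, Submodule.coe_add, inner_add_left]
    ring
  smul_left u v r := by
    simp only [map_smul, LinearMap.map_smulₛₗ₂, Submodule.coe_smul, inner_smul_left, smul_eq_mul]
    ring

instance : SeminormedAddCommGroup t.FormSpace :=
  @InnerProductSpace.Core.toSeminormedAddCommGroup ℂ t.FormSpace _ _ _ t.formCore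

instance : InnerProductSpace ℂ t.FormSpace := InnerProductSpace.ofCore t.formCore

theorem inner_toFS (u v : t.domain) :
    inner ℂ (t.toFS u) (t.toFS v) =
      t.form u v + ((1 - t.bound : ℝ) : ℂ) * inner ℂ (u : H) (v : H) := rfl

theorem norm_toFS_sq (u : t.domain) :
    ‖t.toFS u‖ ^ 2 = t.quad u + (1 - t.bound) * ‖(u : H)‖ ^ 2 := by
  have h2 : (inner ℂ (u : H) (u : H) : ℂ) = ((‖(u : H)‖ ^ 2 : ℝ) : ℂ) := by
    rw [inner_self_eq_norm_sq_to_K]; push_cast; rfl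
  rw [← inner_self_eq_norm_sq (𝕜 := ℂ), inner_toFS, h2, ← Complex.ofReal_mul]
  simp only [quad, RCLike.re_to_complex, Complex.add_re, Complex.ofReal_re]

theorem norm_le_norm_toFS (u : t.domain) : ‖(u : H)‖ ≤ ‖t.toFS u‖ := by
  refine (abs_le_of_sq_le_sq' ?_ (norm_nonneg _)).2
  have h : t.bound * ‖(u : H)‖ ^ 2 ≤ t.quad u := t.lower_bound.choose_spec u
  rw [norm_toFS_sq]
  nlinarith

theorem tendsto_toFS_iff {ι : Type*} {l : Filter ι} (z : ι → t.domain) :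
    Tendsto (fun i => ‖t.toFS (z i)‖) l (𝓝 0) ↔
      Tendsto (fun i => (z i : H)) l (𝓝 0) ∧ Tendsto (fun i => t.quad (z i)) l (𝓝 0) := by
  constructor
  · intro h
    have h1 : Tendsto (fun i => ‖(z i : H)‖) l (𝓝 0) :=
      squeeze_zero (fun _ => norm_nonneg _) (fun i => t.norm_le_norm_toFS (z i)) h
    refine ⟨tendsto_zero_iff_norm_tendsto_zero.2 h1, ?_⟩
    have h2 := (h.pow 2).sub ((h1.pow 2).const_mul (1 - t.bound))
    simp only [norm_toFS_sq] at h2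
    simpa using h2
  · rintro ⟨h1, h2⟩
    have h3 := h2.add ((h1.norm.pow 2).const_mul (1 - t.bound))
    simp only [← norm_toFS_sq] at h3
    have h4 := h3.sqrt
    simpa [Real.sqrt_sq] using h4

theorem convergesTo_iff (u : ℕ → t.domain) (x : H) :
    t.ConvergesTo u x ↔
      Tendsto (fun n => (u n : H)) atTop (𝓝 x) ∧ CauchySeq (fun n => t.toFS (u n)) := by
  refine and_congr_right fun hx => ?_
  rw [cauchySeq_iff_tendsto_dist_atTop_0]
  simp only [dist_eq_norm, ← map_sub]
  rw [t.tendsto_toFS_iff (fun p : ℕ × ℕ => u p.1 - u p.2)]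
  refine (and_iff_right ?_).symm
  rw [← prod_atTop_atTop_eq]
  simpa using (hx.comp tendsto_fst).sub (hx.comp tendsto_snd)

variable {t}

theorem ConvergesTo.add {u v : ℕ → t.domain} {x y : H} (hu : t.ConvergesTo u x)
    (hv : t.ConvergesTo v y) : t.ConvergesTo (fun n => u n + v n) (x + y) := by
  rw [convergesTo_iff] at *
  refine ⟨by simpa using hu.1.add hv.1, ?_⟩
  simp only [map_add]
  exact hu.2.add hv.2

theorem ConvergesTo.smul {u : ℕ → t.domain} {x : H} (c : ℂ) (hu : t.ConvergesTo u x) :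
    t.ConvergesTo (fun n => c • u n) (c • x) := by
  rw [convergesTo_iff] at *
  refine ⟨by simpa using hu.1.const_smul c, ?_⟩
  simp only [map_smul]
  exact (uniformContinuous_const_smul c).comp_cauchySeq hu.2

theorem ConvergesTo.sub {u v : ℕ → t.domain} {x y : H} (hu : t.ConvergesTo u x)
    (hv : t.ConvergesTo v y) : t.ConvergesTo (fun n => u n - v n) (x - y) := by
  simpa [sub_eq_add_neg] using hu.add (hv.smul (-1))

theorem convergesTo_const (u : t.domain) : t.ConvergesTo (fun _ => u) u := by
  rw [convergesTo_iff]
  exact ⟨tendsto_const_nhds, cauchySeq_const _⟩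

/-- A `t`-convergent sequence converges in the completion of the form norm. -/
theorem ConvergesTo.exists_lim {u : ℕ → t.domain} {x : H} (hu : t.ConvergesTo u x) :
    ∃ a : UniformSpace.Completion t.FormSpace,
      Tendsto (fun n => (t.toFS (u n) : UniformSpace.Completion t.FormSpace)) atTop (𝓝 a) :=
  cauchySeq_tendsto_of_complete
    (((convergesTo_iff t u x).1 hu).2.map (UniformSpace.Completion.uniformContinuous_coe _))

theorem tendsto_form {u v : ℕ → t.domain} {x y : H} (hu : t.ConvergesTo u x)
    (hv : t.ConvergesTo v y) {a b : UniformSpace.Completion t.FormSpace}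
    (ha : Tendsto (fun n => (t.toFS (u n) : UniformSpace.Completion t.FormSpace)) atTop (𝓝 a))
    (hb : Tendsto (fun n => (t.toFS (v n) : UniformSpace.Completion t.FormSpace)) atTop (𝓝 b)) :
    Tendsto (fun n => t.form (u n) (v n)) atTop
      (𝓝 (inner ℂ a b - ((1 - t.bound : ℝ) : ℂ) * inner ℂ x y)) := by
  have h1 := (ha.inner (𝕜 := ℂ) hb).sub
    ((hu.1.inner (𝕜 := ℂ) hv.1).const_mul ((1 - t.bound : ℝ) : ℂ))
  refine h1.congr fun n => ?_
  rw [UniformSpace.Completion.inner_coe, inner_toFS]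
  ring

theorem lim_unique (ht : t.IsClosable) {u v : ℕ → t.domain} {x : H} (hu : t.ConvergesTo u x)
    (hv : t.ConvergesTo v x) {a b : UniformSpace.Completion t.FormSpace}
    (ha : Tendsto (fun n => (t.toFS (u n) : UniformSpace.Completion t.FormSpace)) atTop (𝓝 a))
    (hb : Tendsto (fun n => (t.toFS (v n) : UniformSpace.Completion t.FormSpace)) atTop (𝓝 b)) :
    a = b := by
  have h0 : t.ConvergesTo (fun n => u n - v n) 0 := by simpa using hu.sub hv
  have h1 := (t.tendsto_toFS_iff (fun n => u n - v n)).2 ⟨h0.1, ht _ h0⟩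
  have h2 := (ha.sub hb).norm
  simp only [← UniformSpace.Completion.coe_sub, UniformSpace.Completion.norm_coe, ← map_sub] at h2
  exact sub_eq_zero.1 (norm_eq_zero.1 (tendsto_nhds_unique h2 h1))

variable (t)

/-- The domain of the closure: all limits of `t`-convergent sequences. -/
def closureDomain : Submodule ℂ H where
  carrier := {x | ∃ u : ℕ → t.domain, t.ConvergesTo u x}
  add_mem' := fun ⟨_, hu⟩ ⟨_, hv⟩ => ⟨_, hu.add hv⟩
  zero_mem' := ⟨_, convergesTo_const 0⟩
  smul_mem' := fun c _ ⟨_, hu⟩ => ⟨_, hu.smul c⟩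

/-- The value `lim t(u n, v n)` of the closure at `x`, `y`, where `u`, `v` are sequences that
are `t`-convergent to `x` and to `y`. If `t` is closable, then it does not depend on the choice of
the sequences. -/
def closureValue (x y : t.closureDomain) : ℂ :=
  limUnder atTop fun n => t.form (x.2.choose n) (y.2.choose n)

variable {t}

theorem tendsto_closureValue (ht : t.IsClosable) {x y : t.closureDomain} {u v : ℕ → t.domain}
    (hu : t.ConvergesTo u x) (hv : t.ConvergesTo v y) :
    Tendsto (fun n => t.form (u n) (v n)) atTop (𝓝 (t.closureValue x y)) := by
  have hx := x.2.choose_spec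
  have hy := y.2.choose_spec
  obtain ⟨a, ha⟩ := hu.exists_lim
  obtain ⟨b, hb⟩ := hv.exists_lim
  obtain ⟨a', ha'⟩ := hx.exists_lim
  obtain ⟨b', hb'⟩ := hy.exists_lim
  obtain rfl := lim_unique ht hu hx ha ha'
  obtain rfl := lim_unique ht hv hy hb hb'
  rw [closureValue, (tendsto_form hx hy ha' hb').limUnder_eq]
  exact tendsto_form hu hv ha hb

/-- The closure of a closable form. -/
def closure (t : SemiboundedForm H) (ht : t.IsClosable) : SemiboundedForm H where
  domain := t.closureDomain
  form := LinearMap.mk₂'ₛₗ _ _ t.closureValue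
    (fun x y z => by
      obtain ⟨u, hu⟩ := x.2
      obtain ⟨v, hv⟩ := y.2
      obtain ⟨w, hw⟩ := z.2
      refine tendsto_nhds_unique (tendsto_closureValue ht (hu.add hv) hw) ?_
      simpa using (tendsto_closureValue ht hu hw).add (tendsto_closureValue ht hv hw))
    (fun c x y => by
      obtain ⟨u, hu⟩ := x.2
      obtain ⟨v, hv⟩ := y.2
      refine tendsto_nhds_unique (tendsto_closureValue ht (hu.smul c) hv) ?_
      simpa using (tendsto_closureValue ht hu hv).const_mul (conj c))
    (fun x y z => by
      obtain ⟨u, hu⟩ := x.2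
      obtain ⟨v, hv⟩ := y.2
      obtain ⟨w, hw⟩ := z.2
      refine tendsto_nhds_unique (tendsto_closureValue ht hu (hv.add hw)) ?_
      simpa using (tendsto_closureValue ht hu hv).add (tendsto_closureValue ht hu hw))
    (fun c x y => by
      obtain ⟨u, hu⟩ := x.2
      obtain ⟨v, hv⟩ := y.2
      refine tendsto_nhds_unique (tendsto_closureValue ht hu (hv.smul c)) ?_
      simpa using (tendsto_closureValue ht hu hv).const_mul c)
  hermitian x y := by
    obtain ⟨u, hu⟩ := x.2
    obtain ⟨v, hv⟩ := y.2
    refine tendsto_nhds_unique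
      ((Complex.continuous_conj.tendsto _).comp (tendsto_closureValue ht hu hv)) ?_
    refine (tendsto_closureValue ht hv hu).congr fun n => ?_
    exact (t.hermitian _ _).symm
  lower_bound := by
    obtain ⟨c, hc⟩ := t.lower_bound
    refine ⟨c, fun x => ?_⟩
    obtain ⟨u, hu⟩ := x.2
    exact le_of_tendsto_of_tendsto' ((hu.1.norm.pow 2).const_mul c)
      ((Complex.continuous_re.tendsto _).comp (tendsto_closureValue ht hu hu)) fun n => hc (u n)

theorem domain_le_closure (ht : t.IsClosable) : t.domain ≤ (t.closure ht).domain :=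
  fun x hx => ⟨_, convergesTo_const ⟨x, hx⟩⟩

theorem closure_quad (ht : t.IsClosable) (u : t.domain) :
    (t.closure ht).quad (Submodule.inclusion (domain_le_closure ht) u) = t.quad u := by
  have h := tendsto_closureValue ht (x := Submodule.inclusion (domain_le_closure ht) u)
    (y := Submodule.inclusion (domain_le_closure ht) u) (convergesTo_const u) (convergesTo_const u)
  exact congrArg Complex.re (tendsto_nhds_unique h tendsto_const_nhds)

theorem tendsto_closure_quad_sub (ht : t.IsClosable) {u : ℕ → t.domain}
    {x : (t.closure ht).domain} (hu : t.ConvergesTo u x) :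
    Tendsto (fun n => (t.closure ht).quad
      (Submodule.inclusion (domain_le_closure ht) (u n) - x)) atTop (𝓝 0) := by
  have h1 : ∀ n, Tendsto (fun m => t.quad (u n - u m)) atTop
      (𝓝 ((t.closure ht).quad (Submodule.inclusion (domain_le_closure ht) (u n) - x))) := by
    intro n
    have h := (convergesTo_const (u n)).sub hu
    exact (Complex.continuous_re.tendsto _).comp (tendsto_closureValue ht
      (x := Submodule.inclusion (domain_le_closure ht) (u n) - x)
      (y := Submodule.inclusion (domain_le_closure ht) (u n) - x) h h)
  rw [Metric.tendsto_atTop]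
  intro ε hε
  obtain ⟨N, hN⟩ := Metric.tendsto_atTop.1 hu.2 (ε / 2) (by positivity)
  refine ⟨max N.1 N.2, fun n hn => ?_⟩
  refine lt_of_le_of_lt (le_of_tendsto ((h1 n).dist tendsto_const_nhds) ?_) (half_lt_self hε)
  filter_upwards [eventually_ge_atTop N.2] with m hm
  exact (hN (n, m) ⟨le_trans (le_max_left _ _) hn, hm⟩).le

theorem closure_isClosed (ht : t.IsClosable) : (t.closure ht).IsClosed := by
  let T := t.closure ht
  intro (x : ℕ → T.domain) y (hxy : T.ConvergesTo x y)
  let i := Submodule.inclusion (domain_le_closure ht)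
  have hex : ∀ n, ∃ w : t.domain, ‖T.toFS (i w - x n)‖ < 1 / ((n : ℝ) + 1) := by
    intro n
    obtain ⟨u, hu⟩ := (x n).2
    have h1 : Tendsto (fun k => ‖T.toFS (i (u k) - x n)‖) atTop (𝓝 0) := by
      rw [T.tendsto_toFS_iff]
      refine ⟨?_, tendsto_closure_quad_sub ht hu⟩
      simpa [i] using hu.1.sub_const (x n : H)
    obtain ⟨k, hk⟩ := (h1.eventually_lt_const (u := 1 / ((n : ℝ) + 1)) (by positivity)).exists
    exact ⟨u k, hk⟩
  choose w hw using hex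
  have hw0 : Tendsto (fun n => ‖T.toFS (i (w n) - x n)‖) atTop (𝓝 0) :=
    squeeze_zero (fun _ => norm_nonneg _) (fun n => (hw n).le)
      tendsto_one_div_add_atTop_nhds_zero_nat
  have hd := (T.tendsto_toFS_iff _).1 hw0
  have hwy : Tendsto (fun n => (w n : H)) atTop (𝓝 y) := by
    have h1 := hd.1.add hxy.1
    rw [zero_add] at h1
    refine h1.congr fun n => ?_
    simp [i]
  have hwC : CauchySeq (fun n => T.toFS (i (w n))) := by
    have h1 : CauchySeq (fun n => T.toFS (i (w n) - x n)) :=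
      (tendsto_zero_iff_norm_tendsto_zero.2 hw0).cauchySeq
    have h2 := h1.add ((T.convergesTo_iff x y).1 hxy).2
    have h3 : ((fun n => T.toFS (i (w n) - x n)) + fun n => T.toFS (x n)) =
        fun n => T.toFS (i (w n)) := by
      funext n
      simp
    rwa [h3] at h2
  have hwT : T.ConvergesTo (fun n => i (w n)) y := (T.convergesTo_iff _ _).2 ⟨hwy, hwC⟩
  have hwt : t.ConvergesTo w y := by
    refine ⟨hwy, hwT.2.congr fun p => ?_⟩
    rw [← closure_quad ht, map_sub]
  have hy : y ∈ T.domain := ⟨w, hwt⟩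
  refine ⟨hy, ?_⟩
  have h2 : Tendsto (fun n => ‖T.toFS (i (w n) - ⟨y, hy⟩)‖) atTop (𝓝 0) := by
    rw [T.tendsto_toFS_iff]
    refine ⟨?_, tendsto_closure_quad_sub ht (x := ⟨y, hy⟩) hwt⟩
    simpa [i] using hwy.sub_const y
  have h3 : Tendsto (fun n => ‖T.toFS (x n - ⟨y, hy⟩)‖) atTop (𝓝 0) := by
    refine squeeze_zero (fun _ => norm_nonneg _) (fun n => ?_) (by simpa using h2.add hw0)
    have : x n - ⟨y, hy⟩ = (i (w n) - ⟨y, hy⟩) - (i (w n) - x n) := by abel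
    rw [this, map_sub]
    exact norm_sub_le _ _
  exact ((T.tendsto_toFS_iff _).1 h3).2

/-- The sum of two forms, with domain `D(s) ∩ D(t)`. -/
def add (s t : SemiboundedForm H) : SemiboundedForm H where
  domain := s.domain ⊓ t.domain
  form := LinearMap.mk₂'ₛₗ _ _
    (fun u v => s.form ⟨u, u.2.1⟩ ⟨v, v.2.1⟩ + t.form ⟨u, u.2.2⟩ ⟨v, v.2.2⟩)
    (fun u v w => by
      have h1 := LinearMap.map_add₂ s.form ⟨u, u.2.1⟩ ⟨v, v.2.1⟩ ⟨w, w.2.1⟩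
      have h2 := LinearMap.map_add₂ t.form ⟨u, u.2.2⟩ ⟨v, v.2.2⟩ ⟨w, w.2.2⟩
      refine (congrArg₂ (· + ·) h1 h2).trans ?_
      ring)
    (fun c u v => by
      have h1 := LinearMap.map_smulₛₗ₂ s.form c ⟨u, u.2.1⟩ ⟨v, v.2.1⟩
      have h2 := LinearMap.map_smulₛₗ₂ t.form c ⟨u, u.2.2⟩ ⟨v, v.2.2⟩
      exact (congrArg₂ (· + ·) h1 h2).trans (smul_add _ _ _).symm)
    (fun u v w => by
      have h1 := map_add (s.form ⟨u, u.2.1⟩) ⟨v, v.2.1⟩ ⟨w, w.2.1⟩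
      have h2 := map_add (t.form ⟨u, u.2.2⟩) ⟨v, v.2.2⟩ ⟨w, w.2.2⟩
      refine (congrArg₂ (· + ·) h1 h2).trans ?_
      ring)
    (fun c u v => by
      have h1 := map_smul (s.form ⟨u, u.2.1⟩) c ⟨v, v.2.1⟩
      have h2 := map_smul (t.form ⟨u, u.2.2⟩) c ⟨v, v.2.2⟩
      exact (congrArg₂ (· + ·) h1 h2).trans (smul_add _ _ _).symm)
  hermitian u v := by
    simp only [LinearMap.mk₂'ₛₗ_apply, map_add, s.hermitian, t.hermitian]
  lower_bound := by
    obtain ⟨c, hc⟩ := s.lower_bound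
    obtain ⟨d, hd⟩ := t.lower_bound
    refine ⟨c + d, fun u => ?_⟩
    have h1 := hc ⟨u, u.2.1⟩
    have h2 := hd ⟨u, u.2.2⟩
    simp only [LinearMap.mk₂'ₛₗ_apply, Complex.add_re]
    simp only at h1 h2
    linarith

theorem add_isClosed {s t : SemiboundedForm H} (hs : s.IsClosed) (ht : t.IsClosed) :
    (s.add t).IsClosed := by
  intro (u : ℕ → (s.add t).domain) x hu
  obtain ⟨c, hc⟩ := s.lower_bound
  obtain ⟨d, hd⟩ := t.lower_bound
  obtain ⟨hux, hq⟩ := hu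
  let us : ℕ → s.domain := fun n => ⟨u n, (u n).2.1⟩
  let ut : ℕ → t.domain := fun n => ⟨u n, (u n).2.2⟩
  have hq' : Tendsto (fun p : ℕ × ℕ => s.quad (us p.1 - us p.2) + t.quad (ut p.1 - ut p.2))
      atTop (𝓝 0) := hq
  have hn : Tendsto (fun p : ℕ × ℕ => ‖(u p.1 : H) - u p.2‖ ^ 2) atTop (𝓝 0) := by
    rw [← prod_atTop_atTop_eq]
    simpa using (((hux.comp tendsto_fst).sub (hux.comp tendsto_snd)).norm).pow 2
  have hS : ∀ p : ℕ × ℕ, c * ‖(u p.1 : H) - u p.2‖ ^ 2 ≤ s.quad (us p.1 - us p.2) :=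
    fun p => hc (us p.1 - us p.2)
  have hT : ∀ p : ℕ × ℕ, d * ‖(u p.1 : H) - u p.2‖ ^ 2 ≤ t.quad (ut p.1 - ut p.2) :=
    fun p => hd (ut p.1 - ut p.2)
  have h1 : s.ConvergesTo us x := by
    refine ⟨hux, tendsto_of_tendsto_of_tendsto_of_le_of_le
      (by simpa using hn.const_mul c) (by simpa using hq'.sub (hn.const_mul d)) hS ?_⟩
    intro p
    have := hT p
    simp only
    linarith
  have h2 : t.ConvergesTo ut x := by
    refine ⟨hux, tendsto_of_tendsto_of_tendsto_of_le_of_le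
      (by simpa using hn.const_mul d) (by simpa using hq'.sub (hn.const_mul c)) hT ?_⟩
    intro p
    have := hS p
    simp only
    linarith
  obtain ⟨hxs, hs'⟩ := hs us x h1
  obtain ⟨hxt, ht'⟩ := ht ut x h2
  refine ⟨⟨hxs, hxt⟩, ?_⟩
  have h3 := hs'.add ht'
  rw [add_zero] at h3
  exact h3

end SemiboundedForm

/-- A densely defined, closed, lower semi-bounded Hermitian form in `H`. -/
structure ClosedForm (H : Type*) [NormedAddCommGroup H] [InnerProductSpace ℂ H]
    extends SemiboundedForm H where
  dense : Dense (domain : Set H)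
  closed : toSemiboundedForm.IsClosed

namespace ClosedForm

variable {H : Type*} [NormedAddCommGroup H] [InnerProductSpace ℂ H]

/-- The sum of two closed lower semi-bounded forms, with domain `D(s) ∩ D(t)`, provided that this
intersection is dense. -/
def add (s t : ClosedForm H) (hd : Dense ((s.domain ⊓ t.domain : Submodule ℂ H) : Set H)) :
    ClosedForm H where
  toSemiboundedForm := s.toSemiboundedForm.add t.toSemiboundedForm
  dense := hd
  closed := SemiboundedForm.add_isClosed s.closed t.closed

/-- The domain of the operator `T` associated with `t`: all `u ∈ D(t)` for which there is `f ∈ H`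
with `t(v, u) = (v, f)` for all `v ∈ D(t)`. -/
def operatorDomain (t : ClosedForm H) : Submodule ℂ H where
  carrier := {u | ∃ hu : u ∈ t.domain, ∃ f : H, ∀ v : t.domain, t.form v ⟨u, hu⟩ = inner ℂ (v : H) f}
  add_mem' := by
    rintro u u' ⟨hu, f, hf⟩ ⟨hu', f', hf'⟩
    refine ⟨add_mem hu hu', f + f', fun v => ?_⟩
    rw [inner_add_right, ← hf, ← hf', ← map_add]
    rfl
  zero_mem' := ⟨zero_mem _, 0, fun v => by
    rw [inner_zero_right]; exact map_zero (t.form v)⟩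
  smul_mem' := by
    rintro c u ⟨hu, f, hf⟩
    refine ⟨Submodule.smul_mem _ c hu, c • f, fun v => ?_⟩
    rw [inner_smul_right, ← hf, ← smul_eq_mul, ← map_smul]
    rfl

theorem operator_unique (t : ClosedForm H) {f g : H}
    (h : ∀ v : t.domain, inner ℂ (v : H) f = inner ℂ (v : H) g) : f = g :=
  t.dense.eq_of_inner_right ℂ fun v hv => h ⟨v, hv⟩

/-- The operator `T` associated with a closed form `t`: `T u = f` if and only if `u ∈ D(t)` and
`t(v, u) = (v, f)` for all `v ∈ D(t)`. -/
def operator (t : ClosedForm H) : H →ₗ.[ℂ] H where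
  domain := t.operatorDomain
  toFun :=
    { toFun := fun u => u.2.choose_spec.choose
      map_add' := fun u u' => t.operator_unique fun v => by
        rw [inner_add_right, ← (u + u').2.choose_spec.choose_spec v,
          ← u.2.choose_spec.choose_spec v, ← u'.2.choose_spec.choose_spec v, ← map_add]
        rfl
      map_smul' := fun c u => t.operator_unique fun v => by
        rw [RingHom.id_apply, inner_smul_right, ← (c • u).2.choose_spec.choose_spec v,
          ← u.2.choose_spec.choose_spec v, ← smul_eq_mul, ← map_smul]
        rfl }

/-- The form-sum of the operators associated with the closed forms `s` and `t`: the operator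
associated with the closed form `s + t`. -/
def formSum (s t : ClosedForm H) (hd : Dense ((s.domain ⊓ t.domain : Submodule ℂ H) : Set H)) :
    H →ₗ.[ℂ] H := (s.add t hd).operator

end ClosedForm

/-! ### The Friedrichs extension -/

section Friedrichs

variable {H : Type*} [NormedAddCommGroup H] [InnerProductSpace ℂ H]

/-- The operator `T` is lower semi-bounded: `(T u, u) ≥ C ‖u‖²` for all `u ∈ D(T)`. -/
def IsLowerSemibounded (T : H →ₗ.[ℂ] H) : Prop :=
  ∃ C : ℝ, ∀ u : T.domain, C * ‖(u : H)‖ ^ 2 ≤ (inner ℂ (T u) (u : H)).re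

/-- The form `(u, v) ↦ (u, T v)` with domain `D(T)` of a symmetric, lower semi-bounded operator. -/
def operatorForm (T : H →ₗ.[ℂ] H) (hs : T.IsFormalAdjoint T) (hb : IsLowerSemibounded T) :
    SemiboundedForm H where
  domain := T.domain
  form := LinearMap.mk₂'ₛₗ _ _ (fun u v => inner ℂ (u : H) (T v))
    (fun u v w => inner_add_left _ _ _)
    (fun c u v => inner_smul_left _ _ _)
    (fun u v w => by rw [T.map_add, inner_add_right])
    (fun c u v => by rw [T.map_smul, inner_smul_right]; rfl)
  hermitian u v := by
    simp only [LinearMap.mk₂'ₛₗ_apply, inner_conj_symm]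
    exact hs v u
  lower_bound := by
    obtain ⟨C, hC⟩ := hb
    refine ⟨C, fun u => ?_⟩
    simp only [LinearMap.mk₂'ₛₗ_apply]
    rw [← hs u u]
    exact hC u

theorem operatorForm_isClosable (T : H →ₗ.[ℂ] H) (hs : T.IsFormalAdjoint T)
    (hb : IsLowerSemibounded T) : (operatorForm T hs hb).IsClosable := by
  let t := operatorForm T hs hb
  intro (u : ℕ → t.domain) (hu : t.ConvergesTo u 0)
  obtain ⟨a, ha⟩ := hu.exists_lim
  have h0 : ∀ v : t.domain, inner ℂ a (t.toFS v : UniformSpace.Completion t.FormSpace) = 0 := by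
    intro v
    have h1 := SemiboundedForm.tendsto_form hu (SemiboundedForm.convergesTo_const v) ha tendsto_const_nhds
    have h2 : Tendsto (fun n => t.form (u n) v) atTop (𝓝 (inner ℂ (0 : H) (T v))) :=
      hu.1.inner tendsto_const_nhds
    simpa using tendsto_nhds_unique h1 h2
  have ha0 : a = 0 := by
    refine UniformSpace.Completion.denseRange_coe.eq_zero_of_inner_left ℂ ?_
    intro v
    exact h0 (t.toFS.symm v)
  have h3 := ha.norm
  simp only [ha0, norm_zero, UniformSpace.Completion.norm_coe] at h3
  exact ((t.tendsto_toFS_iff u).1 h3).2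

/-- The closure of the form `(u, v) ↦ (u, T v)`, `u, v ∈ D(T)`, of a densely defined, symmetric,
lower semi-bounded operator. -/
def friedrichsForm (T : H →ₗ.[ℂ] H) (hd : Dense (T.domain : Set H)) (hs : T.IsFormalAdjoint T)
    (hb : IsLowerSemibounded T) : ClosedForm H where
  toSemiboundedForm := (operatorForm T hs hb).closure (operatorForm_isClosable T hs hb)
  dense := hd.mono (SemiboundedForm.domain_le_closure (operatorForm_isClosable T hs hb))
  closed := SemiboundedForm.closure_isClosed (operatorForm_isClosable T hs hb)

/-- The Friedrichs extension of a densely defined, symmetric, lower semi-bounded operator. -/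
def friedrichsExtension (T : H →ₗ.[ℂ] H) (hd : Dense (T.domain : Set H))
    (hs : T.IsFormalAdjoint T) (hb : IsLowerSemibounded T) : H →ₗ.[ℂ] H :=
  (friedrichsForm T hd hs hb).operator

end Friedrichs

/-! ### Weighted graphs and their Schrödinger operators -/

/-- A weighted graph `(X, b, μ)`: a symmetric edge weight `b` that vanishes on the diagonal and
is summable at each vertex, and a positive vertex weight `μ`. -/
structure WeightedGraph (X : Type*) where
  b : X → X → ℝ
  b_nonneg : ∀ x y, 0 ≤ b x y
  b_symm : ∀ x y, b x y = b y x
  b_self : ∀ x, b x x = 0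
  b_summable : ∀ x, Summable fun y => b x y
  μ : X → ℝ
  μ_pos : ∀ x, 0 < μ x

/-- The functions `f` on `X` with `∑ x, w x * |f x|² < ∞`, for a weight `w ≥ 0`. -/
def weightedEllTwo {X : Type*} (w : X → ℝ) (hw : ∀ x, 0 ≤ w x) : Submodule ℂ (X → ℂ) where
  carrier := {f | Summable fun x => w x * ‖f x‖ ^ 2}
  add_mem' := by
    intro f g (hf : Summable _) (hg : Summable _)
    refine Summable.of_nonneg_of_le (fun x => mul_nonneg (hw x) (sq_nonneg _)) (fun x => ?_)
      ((hf.mul_left 2).add (hg.mul_left 2))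
    have h1 : ‖f x + g x‖ ^ 2 ≤ 2 * ‖f x‖ ^ 2 + 2 * ‖g x‖ ^ 2 := by
      have := norm_add_le (f x) (g x)
      nlinarith [sq_nonneg (‖f x‖ - ‖g x‖), norm_nonneg (f x + g x)]
    have := mul_le_mul_of_nonneg_left h1 (hw x)
    simp only [Pi.add_apply]
    linarith
  zero_mem' := by simp
  smul_mem' := by
    intro c f (hf : Summable _)
    refine (hf.mul_left (‖c‖ ^ 2)).congr fun x => ?_
    simp only [Pi.smul_apply, smul_eq_mul, norm_mul]
    ring

theorem summable_weighted_mul {X : Type*} {w : X → ℝ} (hw : ∀ x, 0 ≤ w x) {f g : X → ℂ}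
    (hf : f ∈ weightedEllTwo w hw) (hg : g ∈ weightedEllTwo w hw) :
    Summable fun x => (w x : ℂ) * (conj (f x) * g x) := by
  have hf' : Summable fun x => w x * ‖f x‖ ^ 2 := hf
  have hg' : Summable fun x => w x * ‖g x‖ ^ 2 := hg
  refine Summable.of_norm_bounded (hf'.add hg') fun x => ?_
  rw [norm_mul, norm_mul, Complex.norm_real, Real.norm_of_nonneg (hw x), RCLike.norm_conj,
    ← mul_add]
  refine mul_le_mul_of_nonneg_left ?_ (hw x)
  nlinarith [sq_nonneg (‖f x‖ - ‖g x‖), sq_nonneg ‖f x‖, sq_nonneg ‖g x‖]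

theorem weighted_mul_self {X : Type*} (w : X → ℝ) (f : X → ℂ) :
    (∑' x, (w x : ℂ) * (conj (f x) * f x)).re = ∑' x, w x * ‖f x‖ ^ 2 := by
  rw [← Complex.ofReal_re (∑' x, w x * ‖f x‖ ^ 2), Complex.ofReal_tsum]
  congr 2
  funext x
  rw [Complex.conj_mul']
  push_cast
  rfl

namespace WeightedGraph

variable {X : Type*} (G : WeightedGraph X)

/-- Every two vertices are joined by a finite path `x₀, …, xₙ` with `b(xⱼ, xⱼ₊₁) > 0`. -/
def Connected : Prop := ∀ x y, Relation.ReflTransGen (fun p q => 0 < G.b p q) x y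

/-- The functions `f` on `X` with `∑ x, μ x * |f x|² < ∞`. -/
def ellTwo : Submodule ℂ (X → ℂ) := weightedEllTwo G.μ fun x => (G.μ_pos x).le

/-- The Hilbert space `ℓ²(X, μ)`. -/
def L2 : Type _ := G.ellTwo

instance : AddCommGroup G.L2 := inferInstanceAs (AddCommGroup G.ellTwo)

instance : Module ℂ G.L2 := inferInstanceAs (Module ℂ G.ellTwo)

/-- An element of `ℓ²(X, μ)` as a function on `X`. -/
def toFun : G.L2 →ₗ[ℂ] (X → ℂ) := G.ellTwo.subtype

/-- A square summable function as an element of `ℓ²(X, μ)`. -/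
def mkL2 (f : X → ℂ) (hf : f ∈ G.ellTwo) : G.L2 := ⟨f, hf⟩

instance : CoeFun G.L2 fun _ => X → ℂ := ⟨fun f => G.toFun f⟩

variable {G}

@[simp] theorem mkL2_apply (f : X → ℂ) (hf : f ∈ G.ellTwo) (x : X) : G.mkL2 f hf x = f x := rfl

@[simp] theorem L2.add_apply (f g : G.L2) (x : X) : (f + g) x = f x + g x := rfl

@[simp] theorem L2.sub_apply (f g : G.L2) (x : X) : (f - g) x = f x - g x := rfl

@[simp] theorem L2.smul_apply (c : ℂ) (f : G.L2) (x : X) : (c • f) x = c * f x := rfl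

@[simp] theorem L2.zero_apply (x : X) : (0 : G.L2) x = 0 := rfl

theorem L2.mem (f : G.L2) : G.toFun f ∈ G.ellTwo := f.2

theorem L2.ext {f g : G.L2} (h : ∀ x, f x = g x) : f = g := Subtype.ext (funext h)

variable (G)

/-- The inner product `∑ x, μ x * conj (f x) * g x` of `ℓ²(X, μ)`. -/
@[reducible]
def core : InnerProductSpace.Core ℂ G.L2 where
  inner f g := ∑' x, (G.μ x : ℂ) * (conj (f x) * g x)
  conj_inner_symm f g := by
    rw [Complex.conj_tsum]
    refine tsum_congr fun x => ?_
    simp only [map_mul, Complex.conj_ofReal, Complex.conj_conj]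
    ring
  re_inner_nonneg f := by
    rw [RCLike.re_to_complex, weighted_mul_self]
    exact tsum_nonneg fun x => mul_nonneg (G.μ_pos x).le (sq_nonneg _)
  add_left f g h := by
    rw [← (summable_weighted_mul _ f.mem h.mem).tsum_add (summable_weighted_mul _ g.mem h.mem)]
    refine tsum_congr fun x => ?_
    simp only [L2.add_apply, map_add]
    ring
  smul_left f g c := by
    rw [← tsum_mul_left]
    refine tsum_congr fun x => ?_
    simp only [L2.smul_apply, map_mul]
    ring
  definite f hf := by
    have h1 := congrArg Complex.re hf
    rw [weighted_mul_self, Complex.zero_re] at h1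
    have h2 : Summable fun x => G.μ x * ‖f x‖ ^ 2 := f.mem
    refine L2.ext fun x => ?_
    have h3 := h2.le_tsum x fun y _ => mul_nonneg (G.μ_pos y).le (sq_nonneg _)
    have h4 : 0 ≤ ‖f x‖ ^ 2 := sq_nonneg _
    have h5 : ‖f x‖ ^ 2 = 0 := by nlinarith [G.μ_pos x]
    simpa using h5

instance : NormedAddCommGroup G.L2 := G.core.toNormedAddCommGroup

instance : InnerProductSpace ℂ G.L2 := InnerProductSpace.ofCore G.core.toCore

theorem inner_def (f g : G.L2) : inner ℂ f g = ∑' x, (G.μ x : ℂ) * (conj (f x) * g x) := rfl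

theorem norm_sq_eq (f : G.L2) : ‖f‖ ^ 2 = ∑' x, G.μ x * ‖f x‖ ^ 2 := by
  rw [← inner_self_eq_norm_sq (𝕜 := ℂ), inner_def, RCLike.re_to_complex, weighted_mul_self]

theorem mul_norm_sq_le (f : G.L2) (x : X) : G.μ x * ‖f x‖ ^ 2 ≤ ‖f‖ ^ 2 := by
  have h2 : Summable fun x => G.μ x * ‖f x‖ ^ 2 := f.mem
  rw [norm_sq_eq]
  exact h2.le_tsum x fun y _ => mul_nonneg (G.μ_pos y).le (sq_nonneg _)

theorem tendsto_apply {ι : Type*} {l : Filter ι} {u : ι → G.L2} {f : G.L2}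
    (h : Tendsto u l (𝓝 f)) (x : X) : Tendsto (fun i => u i x) l (𝓝 (f x)) := by
  rw [tendsto_iff_norm_sub_tendsto_zero] at h ⊢
  have h1 : Tendsto (fun i => (G.μ x)⁻¹ * ‖u i - f‖ ^ 2) l (𝓝 0) := by
    simpa using (h.pow 2).const_mul (G.μ x)⁻¹
  have h2 : Tendsto (fun i => ‖u i x - f x‖ ^ 2) l (𝓝 0) := by
    refine squeeze_zero (fun _ => sq_nonneg _) (fun i => ?_) h1
    rw [le_inv_mul_iff₀ (G.μ_pos x)]
    exact G.mul_norm_sq_le (u i - f) x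
  simpa [Real.sqrt_sq] using h2.sqrt

theorem mem_ellTwo_of_finite {f : X → ℂ} (hf : f.support.Finite) : f ∈ G.ellTwo := by
  refine summable_of_hasFiniteSupport (hf.subset fun x hx => ?_)
  contrapose! hx
  simp [Function.notMem_support.1 hx]

/-- `C_c(X)`: the finitely supported functions, as a subspace of `ℓ²(X, μ)`. -/
def finSupp : Submodule ℂ G.L2 where
  carrier := {f | (G.toFun f).support.Finite}
  add_mem' := fun hf hg => (hf.union hg).subset (Function.support_add _ _)
  zero_mem' := by simp
  smul_mem' := fun c _ hf => hf.subset (Function.support_const_smul_subset c _)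

theorem dense_finSupp : Dense (G.finSupp : Set G.L2) := by
  classical
  intro f
  rw [Metric.mem_closure_iff]
  intro ε hε
  have hf : Summable fun x => G.μ x * ‖f x‖ ^ 2 := f.mem
  obtain ⟨s, hs⟩ := (hf.hasSum.eventually (lt_mem_nhds
    (sub_lt_self (∑' x, G.μ x * ‖f x‖ ^ 2) (pow_pos hε 2)))).exists
  let g : X → ℂ := fun x => if x ∈ s then f x else 0
  have hg : g.support.Finite := s.finite_toSet.subset fun x hx => by
    by_contra h
    exact hx (if_neg h)
  refine ⟨G.mkL2 g (G.mem_ellTwo_of_finite hg), hg, ?_⟩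
  rw [dist_eq_norm]
  refine lt_of_pow_lt_pow_left₀ 2 hε.le ?_
  rw [norm_sq_eq]
  have h1 : ∑' x, G.μ x * ‖(f - G.mkL2 g (G.mem_ellTwo_of_finite hg)) x‖ ^ 2 =
      ∑' x, (G.μ x * ‖f x‖ ^ 2 - if x ∈ s then G.μ x * ‖f x‖ ^ 2 else 0) := by
    refine tsum_congr fun x => ?_
    simp only [L2.sub_apply, mkL2_apply, g]
    split_ifs <;> simp
  have h2 : HasSum (fun x => if x ∈ s then G.μ x * ‖f x‖ ^ 2 else 0)
      (∑ x ∈ s, G.μ x * ‖f x‖ ^ 2) := by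
    have h3 : ∑ x ∈ s, G.μ x * ‖f x‖ ^ 2 =
        ∑ x ∈ s, if x ∈ s then G.μ x * ‖f x‖ ^ 2 else 0 :=
      Finset.sum_congr rfl fun x hx => (if_pos hx).symm
    rw [h3]
    exact hasSum_sum_of_ne_finset_zero fun x hx => if_neg hx
  rw [h1, (hf.hasSum.sub h2).tsum_eq]
  linarith

/-- The finiteness condition: `y ↦ b(x, y) / μ(y)` belongs to `ℓ²(X, μ)` for all `x`. -/
def FinitenessCondition : Prop :=
  ∀ x, (fun y => ((G.b x y / G.μ y : ℝ) : ℂ)) ∈ G.ellTwo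

/-- The formal Schrödinger operator
`f ↦ (x ↦ (1 / μ(x)) ∑ y, b(x, y) (f(x) - f(y)) + V(x) f(x))`. The sum converges absolutely for
the functions `f` with `∑ y, b(x, y) |f(y)| < ∞` for all `x`, in particular for those with finite
support, the only ones to which it is applied here. -/
def formalSchrodinger (V : X → ℝ) (f : X → ℂ) (x : X) : ℂ :=
  1 / (G.μ x : ℂ) * ∑' y, (G.b x y : ℂ) * (f x - f y) + (V x : ℂ) * f x

theorem hasSum_laplacian {f : X → ℂ} {s : Finset X} (hs : f.support ⊆ s) (x : X) :
    HasSum (fun y => (G.b x y : ℂ) * (f x - f y))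
      (((∑' y, G.b x y : ℝ) : ℂ) * f x - ∑ y ∈ s, (G.b x y : ℂ) * f y) := by
  have h1 : HasSum (fun y => (G.b x y : ℂ) * f x) (((∑' y, G.b x y : ℝ) : ℂ) * f x) :=
    (Complex.hasSum_ofReal.2 (G.b_summable x).hasSum).mul_right (f x)
  have h2 : HasSum (fun y => (G.b x y : ℂ) * f y) (∑ y ∈ s, (G.b x y : ℂ) * f y) := by
    refine hasSum_sum_of_ne_finset_zero fun y hy => ?_
    have : f y = 0 := by
      by_contra h
      exact hy (hs h)
    simp [this]
  simpa [mul_sub] using h1.sub h2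

theorem formalSchrodinger_eq (V : X → ℝ) {f : X → ℂ} {s : Finset X} (hs : f.support ⊆ s) (x : X) :
    G.formalSchrodinger V f x =
      (((∑' y, G.b x y : ℝ) : ℂ) / (G.μ x : ℂ) + (V x : ℂ)) * f x -
        ∑ y ∈ s, f y * ((G.b y x / G.μ x : ℝ) : ℂ) := by
  rw [formalSchrodinger, (G.hasSum_laplacian hs x).tsum_eq, mul_sub, Finset.mul_sum]
  have : ∑ y ∈ s, 1 / (G.μ x : ℂ) * ((G.b x y : ℂ) * f y) =
      ∑ y ∈ s, f y * ((G.b y x / G.μ x : ℝ) : ℂ) := by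
    refine Finset.sum_congr rfl fun y _ => ?_
    rw [G.b_symm x y]
    push_cast
    ring
  rw [this]
  ring

variable {G}

theorem formalSchrodinger_mem (hFC : G.FinitenessCondition) (V : X → ℝ) {f : X → ℂ}
    (hf : f.support.Finite) : G.formalSchrodinger V f ∈ G.ellTwo := by
  have h : G.formalSchrodinger V f =
      (fun x => (((∑' y, G.b x y : ℝ) : ℂ) / (G.μ x : ℂ) + (V x : ℂ)) * f x) -
        ∑ y ∈ hf.toFinset, f y • (fun x => ((G.b y x / G.μ x : ℝ) : ℂ)) := by
    funext x
    rw [G.formalSchrodinger_eq V (s := hf.toFinset) (by simp) x]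
    simp
  rw [h]
  refine sub_mem (G.mem_ellTwo_of_finite (hf.subset fun x hx => ?_))
    (sum_mem fun y _ => Submodule.smul_mem _ _ (hFC y))
  exact right_ne_zero_of_mul hx

/-- The Schrödinger operator with potential `V` and domain `C_c(X)`, as an operator in
`ℓ²(X, μ)`. -/
def schrodinger (hFC : G.FinitenessCondition) (V : X → ℝ) : G.L2 →ₗ.[ℂ] G.L2 where
  domain := G.finSupp
  toFun :=
    { toFun := fun f => G.mkL2 (G.formalSchrodinger V (f : G.L2)) (formalSchrodinger_mem hFC V f.2)
      map_add' := by
        intro f g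
        refine L2.ext fun x => ?_
        have hf' : (G.toFun (f : G.L2)).support.Finite := f.2
        have hf := G.hasSum_laplacian hf'.coe_toFinset.ge x
        have hg' : (G.toFun (g : G.L2)).support.Finite := g.2
        have hg := G.hasSum_laplacian hg'.coe_toFinset.ge x
        have h : ∑' y, (G.b x y : ℂ) * (((f + g : G.finSupp) : G.L2) x - ((f + g : G.finSupp) : G.L2) y)
            = ∑' y, (G.b x y : ℂ) * ((f : G.L2) x - (f : G.L2) y) +
              ∑' y, (G.b x y : ℂ) * ((g : G.L2) x - (g : G.L2) y) := by
          rw [← hf.summable.tsum_add hg.summable]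
          refine tsum_congr fun y => ?_
          simp only [Submodule.coe_add, L2.add_apply]
          ring
        simp only [mkL2_apply, L2.add_apply, formalSchrodinger, h]
        simp only [Submodule.coe_add, L2.add_apply]
        ring
      map_smul' := by
        intro c f
        refine L2.ext fun x => ?_
        have h : ∑' y, (G.b x y : ℂ) * (((c • f : G.finSupp) : G.L2) x - ((c • f : G.finSupp) : G.L2) y)
            = c * ∑' y, (G.b x y : ℂ) * ((f : G.L2) x - (f : G.L2) y) := by
          rw [← tsum_mul_left]
          refine tsum_congr fun y => ?_
          simp only [Submodule.coe_smul, L2.smul_apply]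
          ring
        simp only [mkL2_apply, RingHom.id_apply, L2.smul_apply, formalSchrodinger, h]
        simp only [Submodule.coe_smul, L2.smul_apply]
        ring }

theorem schrodinger_apply (hFC : G.FinitenessCondition) (V : X → ℝ) (f : G.finSupp) (x : X) :
    (schrodinger hFC V f) x = G.formalSchrodinger V (f : G.L2) x := rfl

theorem schrodinger_symmetric (hFC : G.FinitenessCondition) (V : X → ℝ) :
    (schrodinger hFC V).IsFormalAdjoint (schrodinger hFC V) := by
  classical
  intro (u : G.finSupp) (v : G.finSupp)
  have hu' : (G.toFun (u : G.L2)).support.Finite := u.2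
  have hv' : (G.toFun (v : G.L2)).support.Finite := v.2
  let s : Finset X := hu'.toFinset ∪ hv'.toFinset
  have hu : (G.toFun (u : G.L2)).support ⊆ s := fun x hx =>
    Finset.mem_union_left _ (hu'.mem_toFinset.2 hx)
  have hv : (G.toFun (v : G.L2)).support ⊆ s := fun x hx =>
    Finset.mem_union_right _ (hv'.mem_toFinset.2 hx)
  have hu0 : ∀ x ∉ s, (u : G.L2) x = 0 := fun x hx => by
    by_contra h
    exact hx (hu h)
  have hv0 : ∀ x ∉ s, (v : G.L2) x = 0 := fun x hx => by
    by_contra h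
    exact hx (hv h)
  rw [inner_def, inner_def, tsum_eq_sum (s := s) fun x hx => by simp [hv0 x hx],
    tsum_eq_sum (s := s) fun x hx => by simp [hu0 x hx]]
  have hμ : ∀ x, (G.μ x : ℂ) ≠ 0 := fun x => Complex.ofReal_ne_zero.2 (G.μ_pos x).ne'
  have hL : ∀ x, (G.μ x : ℂ) * (conj ((schrodinger hFC V u) x) * (v : G.L2) x) =
      (((∑' y, G.b x y : ℝ) : ℂ) + (G.μ x : ℂ) * (V x : ℂ)) * (conj ((u : G.L2) x) * (v : G.L2) x) -
        ∑ y ∈ s, (G.b y x : ℂ) * (conj ((u : G.L2) y) * (v : G.L2) x) := by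
    intro x
    rw [schrodinger_apply, G.formalSchrodinger_eq V hu, map_sub, map_sum]
    simp only [map_mul, map_add, map_div₀, Complex.conj_ofReal, Complex.ofReal_div]
    rw [sub_mul, mul_sub, Finset.sum_mul, Finset.mul_sum]
    congr 1
    · field_simp [hμ x]
    · refine Finset.sum_congr rfl fun y _ => ?_
      field_simp [hμ x]
  have hR : ∀ x, (G.μ x : ℂ) * (conj ((u : G.L2) x) * (schrodinger hFC V v) x) =
      (((∑' y, G.b x y : ℝ) : ℂ) + (G.μ x : ℂ) * (V x : ℂ)) * (conj ((u : G.L2) x) * (v : G.L2) x) -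
        ∑ y ∈ s, (G.b y x : ℂ) * (conj ((u : G.L2) x) * (v : G.L2) y) := by
    intro x
    rw [schrodinger_apply, G.formalSchrodinger_eq V hv]
    simp only [Complex.ofReal_div]
    rw [mul_sub, mul_sub, Finset.mul_sum, Finset.mul_sum]
    congr 1
    · field_simp [hμ x]
    · refine Finset.sum_congr rfl fun y _ => ?_
      field_simp [hμ x]
  rw [Finset.sum_congr rfl fun x _ => hL x, Finset.sum_congr rfl fun x _ => hR x,
    Finset.sum_sub_distrib, Finset.sum_sub_distrib, Finset.sum_comm]
  simp only [G.b_symm]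

theorem schrodinger_add_lowerSemibounded (hFC : G.FinitenessCondition) {V₁ V₂ : X → ℝ}
    (hV₂ : ∀ x, 0 ≤ V₂ x) (hb : IsLowerSemibounded (schrodinger hFC V₁)) :
    IsLowerSemibounded (schrodinger hFC (V₁ + V₂)) := by
  obtain ⟨C, hC⟩ := hb
  refine ⟨C, fun (u : G.finSupp) => (hC u).trans ?_⟩
  let w : G.L2 := G.mkL2 (fun x => (V₂ x : ℂ) * (u : G.L2) x)
    (G.mem_ellTwo_of_finite (Set.Finite.subset u.2 fun x hx => right_ne_zero_of_mul hx))
  have h : schrodinger hFC (V₁ + V₂) u = schrodinger hFC V₁ u + w := by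
    refine L2.ext fun x => ?_
    rw [L2.add_apply, schrodinger_apply, schrodinger_apply]
    simp only [formalSchrodinger, Pi.add_apply, w, mkL2_apply]
    push_cast
    ring
  rw [h, inner_add_left, Complex.add_re]
  refine le_add_of_nonneg_right ?_
  have h2 : inner ℂ w (u : G.L2) = ∑' x, ((G.μ x * V₂ x : ℝ) : ℂ) *
      (conj ((u : G.L2) x) * (u : G.L2) x) := by
    rw [inner_def]
    refine tsum_congr fun x => ?_
    simp only [w, mkL2_apply, map_mul, Complex.conj_ofReal]
    push_cast
    ring
  rw [h2, weighted_mul_self fun x => G.μ x * V₂ x]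
  exact tsum_nonneg fun x =>
    mul_nonneg (mul_nonneg (G.μ_pos x).le (hV₂ x)) (sq_nonneg _)

/-! ### Multiplication by a non-negative function -/

/-- The form `q(u, v) = ∑ x, μ(x) V(x) conj (u(x)) v(x)` of multiplication by `V ≥ 0`, with domain
`{u ∈ ℓ²(X, μ) | ∑ x, μ(x) V(x) |u(x)|² < ∞}`. -/
def mulForm (G : WeightedGraph X) (V : X → ℝ) (hV : ∀ x, 0 ≤ V x) : SemiboundedForm G.L2 where
  domain := (weightedEllTwo (fun x => G.μ x * V x)
    fun x => mul_nonneg (G.μ_pos x).le (hV x)).comap G.toFun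
  form := LinearMap.mk₂'ₛₗ _ _
    (fun u v => ∑' x, ((G.μ x * V x : ℝ) : ℂ) * (conj ((u : G.L2) x) * (v : G.L2) x))
    (fun u v w => by
      rw [← (summable_weighted_mul (fun x => mul_nonneg (G.μ_pos x).le (hV x)) u.2 w.2).tsum_add
        (summable_weighted_mul (fun x => mul_nonneg (G.μ_pos x).le (hV x)) v.2 w.2)]
      refine tsum_congr fun x => ?_
      simp only [Submodule.coe_add, L2.add_apply, map_add]
      ring)
    (fun c u v => by
      rw [smul_eq_mul, ← tsum_mul_left]
      refine tsum_congr fun x => ?_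
      simp only [Submodule.coe_smul, L2.smul_apply, map_mul]
      ring)
    (fun u v w => by
      rw [← (summable_weighted_mul (fun x => mul_nonneg (G.μ_pos x).le (hV x)) u.2 v.2).tsum_add
        (summable_weighted_mul (fun x => mul_nonneg (G.μ_pos x).le (hV x)) u.2 w.2)]
      refine tsum_congr fun x => ?_
      simp only [Submodule.coe_add, L2.add_apply]
      ring)
    (fun c u v => by
      rw [smul_eq_mul, ← tsum_mul_left]
      refine tsum_congr fun x => ?_
      simp only [Submodule.coe_smul, L2.smul_apply, RingHom.id_apply]
      ring)
  hermitian u v := by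
    simp only [LinearMap.mk₂'ₛₗ_apply]
    rw [Complex.conj_tsum]
    refine tsum_congr fun x => ?_
    simp only [map_mul, Complex.conj_ofReal, Complex.conj_conj]
    ring
  lower_bound := ⟨0, fun u => by
    rw [LinearMap.mk₂'ₛₗ_apply, weighted_mul_self (fun x => G.μ x * V x), zero_mul]
    exact tsum_nonneg fun x => mul_nonneg (mul_nonneg (G.μ_pos x).le (hV x)) (sq_nonneg _)⟩

theorem mulForm_quad (V : X → ℝ) (hV : ∀ x, 0 ≤ V x) (u : (G.mulForm V hV).domain) :
    (G.mulForm V hV).quad u = ∑' x, G.μ x * V x * ‖(u : G.L2) x‖ ^ 2 :=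
  weighted_mul_self (fun x => G.μ x * V x) _

theorem finSupp_le_mulForm (V : X → ℝ) (hV : ∀ x, 0 ≤ V x) :
    G.finSupp ≤ (G.mulForm V hV).domain := by
  intro u hu
  refine summable_of_hasFiniteSupport (Set.Finite.subset hu fun x hx => ?_)
  contrapose! hx
  simp [Function.notMem_support.1 hx]

theorem mulForm_isClosed (V : X → ℝ) (hV : ∀ x, 0 ≤ V x) : (G.mulForm V hV).IsClosed := by
  intro u f hu
  obtain ⟨huf, hq⟩ := hu
  have hw : ∀ x, 0 ≤ G.μ x * V x := fun x => mul_nonneg (G.μ_pos x).le (hV x)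
  have hsum : ∀ v : (G.mulForm V hV).domain,
      Summable fun x => G.μ x * V x * ‖(v : G.L2) x‖ ^ 2 := fun v => v.2
  have key : ∀ ε > 0, ∃ N, ∀ n ≥ N, ∀ s : Finset X,
      ∑ x ∈ s, G.μ x * V x * ‖((u n : G.L2) - f) x‖ ^ 2 ≤ ε := by
    intro ε hε
    obtain ⟨N, hN⟩ := Metric.tendsto_atTop.1 hq ε hε
    refine ⟨max N.1 N.2, fun n hn s => ?_⟩
    have h1 : Tendsto (fun m => ∑ x ∈ s, G.μ x * V x * ‖((u n : G.L2) - u m) x‖ ^ 2) atTop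
        (𝓝 (∑ x ∈ s, G.μ x * V x * ‖((u n : G.L2) - f) x‖ ^ 2)) := by
      refine tendsto_finsetSum _ fun x _ => Tendsto.const_mul _ ?_
      simp only [L2.sub_apply]
      exact ((tendsto_const_nhds.sub (G.tendsto_apply huf x)).norm).pow 2
    refine le_of_tendsto h1 ?_
    filter_upwards [eventually_ge_atTop N.2] with m hm
    have h2 := hN (n, m) ⟨le_trans (le_max_left _ _) hn, hm⟩
    rw [Real.dist_eq, sub_zero, mulForm_quad] at h2
    have h3 := (hsum (u n - u m)).sum_le_tsum s fun x _ => mul_nonneg (hw x) (sq_nonneg _)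
    exact h3.trans ((le_abs_self _).trans h2.le)
  have hmem : f ∈ (G.mulForm V hV).domain := by
    obtain ⟨N, hN⟩ := key 1 one_pos
    have h1 : (u N : G.L2) - f ∈ (G.mulForm V hV).domain :=
      summable_of_sum_le (fun x => mul_nonneg (hw x) (sq_nonneg _)) (hN N le_rfl)
    simpa using sub_mem (u N).2 h1
  refine ⟨hmem, Metric.tendsto_atTop.2 fun ε hε => ?_⟩
  obtain ⟨N, hN⟩ := key (ε / 2) (half_pos hε)
  refine ⟨N, fun n hn => ?_⟩
  rw [Real.dist_eq, sub_zero, mulForm_quad,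
    abs_of_nonneg (tsum_nonneg fun x => mul_nonneg (hw x) (sq_nonneg _))]
  refine lt_of_le_of_lt ?_ (half_lt_self hε)
  exact Real.tsum_le_of_sum_le (fun x => mul_nonneg (hw x) (sq_nonneg _)) (hN n hn)

/-- The form `mulForm` as a densely defined closed form. -/
def closedMulForm (G : WeightedGraph X) (V : X → ℝ) (hV : ∀ x, 0 ≤ V x) : ClosedForm G.L2 where
  toSemiboundedForm := G.mulForm V hV
  dense := G.dense_finSupp.mono (finSupp_le_mulForm V hV)
  closed := mulForm_isClosed V hV

/-- The maximal multiplication operator `u ↦ V u` with domain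
`{u ∈ ℓ²(X, μ) | V u ∈ ℓ²(X, μ)}`. -/
def maxMul (G : WeightedGraph X) (V : X → ℝ) : G.L2 →ₗ.[ℂ] G.L2 where
  domain :=
    { carrier := {u | (fun x => (V x : ℂ) * u x) ∈ G.ellTwo}
      add_mem' := fun {u v} hu hv => by
        have h : (fun x => (V x : ℂ) * (u + v) x) =
            (fun x => (V x : ℂ) * u x) + fun x => (V x : ℂ) * v x := by
          funext x
          simp [mul_add]
        rw [Set.mem_ofPred_eq, h]
        exact G.ellTwo.add_mem hu hv
      zero_mem' := by
        have h : (fun x => (V x : ℂ) * (0 : G.L2) x) = 0 := by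
          funext x
          simp
        rw [Set.mem_ofPred_eq, h]
        exact G.ellTwo.zero_mem
      smul_mem' := fun c u hu => by
        have h : (fun x => (V x : ℂ) * (c • u) x) = c • fun x => (V x : ℂ) * u x := by
          funext x
          simp [mul_left_comm]
        rw [Set.mem_ofPred_eq, h]
        exact G.ellTwo.smul_mem c hu }
  toFun :=
    { toFun := fun u => G.mkL2 (fun x => (V x : ℂ) * (u : G.L2) x) u.2
      map_add' := fun u v => L2.ext fun x => by simp [mul_add]
      map_smul' := fun c u => L2.ext fun x => by simp [mul_left_comm] }

/-! ### The operators of the theorem -/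

/-- The closure of the form `(u, v) ↦ (u, 𝓛_V v)`, `u, v ∈ C_c(X)`. -/
def schrodingerForm (hFC : G.FinitenessCondition) (V : X → ℝ)
    (hb : IsLowerSemibounded (schrodinger hFC V)) : ClosedForm G.L2 :=
  friedrichsForm (schrodinger hFC V) G.dense_finSupp (schrodinger_symmetric hFC V) hb

/-- The Friedrichs extension of the Schrödinger operator with potential `V` on `C_c(X)`. -/
def schrodingerFriedrichs (hFC : G.FinitenessCondition) (V : X → ℝ)
    (hb : IsLowerSemibounded (schrodinger hFC V)) : G.L2 →ₗ.[ℂ] G.L2 :=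
  friedrichsExtension (schrodinger hFC V) G.dense_finSupp (schrodinger_symmetric hFC V) hb

theorem dense_form_domains (hFC : G.FinitenessCondition) {V₁ V₂ : X → ℝ}
    (hb : IsLowerSemibounded (schrodinger hFC V₁)) (hV₂ : ∀ x, 0 ≤ V₂ x) :
    Dense (((schrodingerForm hFC V₁ hb).domain ⊓ (G.closedMulForm V₂ hV₂).domain :
      Submodule ℂ G.L2) : Set G.L2) :=
  G.dense_finSupp.mono (le_inf
    (SemiboundedForm.domain_le_closure (operatorForm_isClosable _ _ _))
    (finSupp_le_mulForm V₂ hV₂))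

end WeightedGraph

end

/-!
A closed form is determined by its form norm, extended by `∞` to a lower semicontinuous function on
the whole space, and the form norm of a closure is the largest lower semicontinuous function below
the original form norm on the original domain. Composition with a contraction of `ℂ` that preserves
absolute values does not increase the form of `𝓛_V` on `C_c(X)`, because `b ≥ 0` and the potential
only sees `|u|`; by the above this passes to `h_V`.

The closure for `V₁ + V₂` is contained in `h_{V₁} + q_{V₂}` because the latter is closed.
Conversely, let `f ∈ D(h_{V₁}) ∩ D(q_{V₂})` be the limit of `uₙ ∈ C_c(X)` in the form norm of
`h_{V₁}`, and truncate the real and imaginary parts of `uₙ` to the segments between `0` and those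
of `f`. The truncation is built from `f` and `uₙ` by linear combinations and the contraction `a ↦
|Re a| + i |Im a|`, so the truncated functions remain bounded in the form norm of `h_{V₁}`. They
are finitely supported, dominated by `|f|` and converge to `f` in `ℓ²(X, μ)`, so lower
semicontinuity puts `f` into the domain of the closure for `V₁ + V₂`.
-/

noncomputable section

open Filter Topology ComplexConjugate
open scoped ENNReal

section Convex

variable {E : Type*} [SeminormedAddCommGroup E] [InnerProductSpace ℝ E]

theorem norm_sub_sq_le_of_convex {K : Set E} (hK : Convex ℝ K) {v w : E} (hv : v ∈ K)
    (hw : w ∈ K) {r : ℝ} (hvr : ‖v‖ ≤ r) (hwr : ‖w‖ ≤ r) :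
    ‖v - w‖ ^ 2 ≤ 4 * (r ^ 2 - Metric.infDist 0 K ^ 2) := by
  have hmid : (1 / 2 : ℝ) • v + (1 / 2 : ℝ) • w ∈ K :=
    hK hv hw (by norm_num) (by norm_num) (by norm_num)
  have hdist : Metric.infDist 0 K ≤ 1 / 2 * ‖v + w‖ := by
    simpa [← smul_add, norm_smul] using Metric.infDist_le_dist_of_mem (x := (0 : E)) hmid
  have hpar := parallelogram_law_with_norm ℝ v w
  have hdist_sq := pow_le_pow_left₀ Metric.infDist_nonneg hdist 2
  have hv_sq := pow_le_pow_left₀ (norm_nonneg v) hvr 2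
  have hw_sq := pow_le_pow_left₀ (norm_nonneg w) hwr 2
  linarith

theorem exists_cauchySeq_mem_of_antitone_convex {K : ℕ → Set E} (hanti : Antitone K)
    (hconv : ∀ n, Convex ℝ (K n)) (hne : ∀ n, (K n).Nonempty)
    (hbdd : Bornology.IsBounded (K 0)) : ∃ v : ℕ → E, (∀ n, v n ∈ K n) ∧ CauchySeq v := by
  let d : ℕ → ℝ := fun n => Metric.infDist 0 (K n)
  have hd_mono : Monotone d := fun n m hnm =>
    Metric.infDist_le_infDist_of_subset (hanti hnm) (hne m)
  have hd_bdd : BddAbove (Set.range d) := by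
    obtain ⟨R, hR⟩ := hbdd.exists_norm_le
    refine ⟨R, Set.forall_mem_range.2 fun n => ?_⟩
    obtain ⟨v, hv⟩ := hne n
    calc d n ≤ dist 0 v := Metric.infDist_le_dist_of_mem hv
      _ = ‖v‖ := dist_zero_left v
      _ ≤ R := hR v (hanti n.zero_le hv)
  have hd_lim := tendsto_atTop_ciSup hd_mono hd_bdd
  have hd_le : ∀ n, d n ≤ ⨆ k, d k := le_ciSup hd_bdd
  set D : ℝ := ⨆ k, d k
  have hex : ∀ n : ℕ, ∃ v ∈ K n, ‖v‖ < d n + 1 / ((n : ℝ) + 1) := fun n => by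
    simpa only [dist_zero_left] using
      (Metric.infDist_lt_iff (hne n)).1 (lt_add_of_pos_right (d n) (by positivity))
  choose v hvK hv using hex
  have hv_le : ∀ n m, n ≤ m → ‖v m‖ ≤ D + 1 / ((n : ℝ) + 1) := fun n m hnm =>
    (hv m).le.trans (add_le_add (hd_le m) (Nat.one_div_le_one_div hnm))
  refine ⟨v, hvK, cauchySeq_of_le_tendsto_0'
    (fun n : ℕ => √(4 * ((D + 1 / ((n : ℝ) + 1)) ^ 2 - d n ^ 2))) (fun n m hnm => ?_) ?_⟩
  · rw [dist_eq_norm]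
    exact Real.le_sqrt_of_sq_le (norm_sub_sq_le_of_convex (hconv n) (hvK n)
      (hanti hnm (hvK m)) (hv_le n n le_rfl) (hv_le n m hnm))
  · have hlim := ((tendsto_one_div_add_atTop_nhds_zero_nat (𝕜 := ℝ)).const_add D).pow 2
    simpa using ((hlim.sub (hd_lim.pow 2)).const_mul 4).sqrt

end Convex

namespace SemiboundedForm

variable {H : Type*} [NormedAddCommGroup H] [InnerProductSpace ℂ H] {t : SemiboundedForm H}

theorem ConvergesTo.tendsto_toFS (ht : t.IsClosed) {u : ℕ → t.domain} {x : t.domain}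
    (hu : t.ConvergesTo u x) : Tendsto (fun n => t.toFS (u n)) atTop (𝓝 (t.toFS x)) := by
  obtain ⟨_, hquad⟩ := ht _ _ hu
  rw [tendsto_iff_norm_sub_tendsto_zero]
  simp only [← map_sub]
  rw [tendsto_toFS_iff]
  exact ⟨by simpa using hu.1.sub_const (x : H), hquad⟩

theorem ConvergesTo.tendsto_form_apply (ht : t.IsClosed) {u v : ℕ → t.domain} {x y : t.domain}
    (hu : t.ConvergesTo u x) (hv : t.ConvergesTo v y) :
    Tendsto (fun n => t.form (u n) (v n)) atTop (𝓝 (t.form x y)) := by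
  have hsub := ((hu.tendsto_toFS ht).inner (𝕜 := ℂ) (hv.tendsto_toFS ht)).sub
    ((hu.1.inner (𝕜 := ℂ) hv.1).const_mul ((1 - t.bound : ℝ) : ℂ))
  simpa [inner_toFS] using hsub

/-- The form norm of `t`, extended to all of `H` by the value `∞` outside `D(t)`. -/
def formENorm (t : SemiboundedForm H) (x : H) : ℝ≥0∞ :=
  ⨅ hx : x ∈ t.domain, ‖t.toFS ⟨x, hx⟩‖ₑ

theorem formENorm_coe (u : t.domain) : t.formENorm u = ‖t.toFS u‖ₑ :=
  iInf_pos u.2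

theorem formENorm_lt_top_iff {x : H} : t.formENorm x < ∞ ↔ x ∈ t.domain := by
  simp [formENorm, iInf_lt_iff]

theorem formENorm_le_formENorm {u v : t.domain} (hnorm : ‖(u : H)‖ = ‖(v : H)‖)
    (hquad : t.quad u ≤ t.quad v) : t.formENorm u ≤ t.formENorm v := by
  rw [formENorm_coe, formENorm_coe, enorm_le_iff_norm_le]
  refine le_of_sq_le_sq ?_ (norm_nonneg _)
  rw [norm_toFS_sq, norm_toFS_sq, hnorm]
  exact add_le_add_left hquad _

theorem formENorm_add_le (x y : H) : t.formENorm (x + y) ≤ t.formENorm x + t.formENorm y := by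
  by_cases hx : x ∈ t.domain
  · by_cases hy : y ∈ t.domain
    · lift x to t.domain using hx
      lift y to t.domain using hy
      rw [← Submodule.coe_add, formENorm_coe, formENorm_coe, formENorm_coe, map_add]
      exact ENNReal.coe_le_coe.2 (nnnorm_add_le (t.toFS x) (t.toFS y))
    · simp [formENorm, hy]
  · simp [formENorm, hx]

theorem formENorm_smul_le {c : ℂ} (hc : ‖c‖ ≤ 1) (x : H) :
    t.formENorm (c • x) ≤ t.formENorm x := by
  by_cases hx : x ∈ t.domain
  · lift x to t.domain using hx
    rw [← Submodule.coe_smul, formENorm_coe, formENorm_coe, map_smul, enorm_le_iff_norm_le,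
      norm_smul]
    exact mul_le_of_le_one_left (norm_nonneg _) hc
  · simp [formENorm, hx]

theorem formENorm_sub_le (x y : H) : t.formENorm (x - y) ≤ t.formENorm x + t.formENorm y := by
  rw [sub_eq_add_neg, ← neg_one_smul ℂ y]
  exact (formENorm_add_le _ _).trans (add_le_add_right (formENorm_smul_le (by simp) y) _)

/-- The inclusion of `D(t)`, equipped with the form norm, into `H`. -/
def formSpaceSubtype (t : SemiboundedForm H) : t.FormSpace →ₗ[ℂ] H :=
  t.domain.subtype ∘ₗ t.toFS.symm.toLinearMap

-- The sets of points of form norm at most `r` near `x` are convex, so that by the parallelogram law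
-- their almost minimal elements form a Cauchy sequence in the form norm.
theorem IsClosed.lowerSemicontinuous_formENorm (ht : t.IsClosed) :
    LowerSemicontinuous t.formENorm := by
  rw [lowerSemicontinuous_iff_isClosed_preimage]
  intro r
  induction r with
  | top => simp
  | coe r => ?_
  refine isClosed_of_closure_subset fun x hx => ?_
  let K : ℕ → Set t.FormSpace := fun n => Metric.closedBall 0 r ∩
    t.formSpaceSubtype.restrictScalars ℝ ⁻¹' Metric.closedBall x (1 / ((n : ℝ) + 1))
  have hK_anti : Antitone K := fun n m hnm => Set.inter_subset_inter_right _
    (Set.preimage_mono (Metric.closedBall_subset_closedBall (Nat.one_div_le_one_div hnm)))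
  have hK_ne : ∀ n, (K n).Nonempty := fun n => by
    obtain ⟨y, hy, hxy⟩ := Metric.mem_closure_iff.1 hx (1 / ((n : ℝ) + 1)) (by positivity)
    lift y to t.domain using formENorm_lt_top_iff.1 (lt_of_le_of_lt hy ENNReal.coe_lt_top)
    refine ⟨t.toFS y, ?_, ?_⟩
    · simpa [formENorm_coe, enorm_le_coe, ← NNReal.coe_le_coe] using hy
    · exact (dist_comm x y ▸ hxy).le
  let _ := InnerProductSpace.complexToReal (G := t.FormSpace)
  obtain ⟨v, hvK, hvC⟩ := exists_cauchySeq_mem_of_antitone_convex hK_anti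
    (fun n => (convex_closedBall _ _).inter ((convex_closedBall x _).linear_preimage _)) hK_ne
    (Metric.isBounded_closedBall.subset Set.inter_subset_left)
  have hvx : Tendsto (fun n => t.formSpaceSubtype (v n)) atTop (𝓝 x) :=
    tendsto_iff_dist_tendsto_zero.2 (squeeze_zero (fun _ => dist_nonneg)
      (fun n => (hvK n).2) tendsto_one_div_add_atTop_nhds_zero_nat)
  have hvt : t.ConvergesTo (fun n => t.toFS.symm (v n)) x :=
    (t.convergesTo_iff _ _).2 ⟨hvx, by simpa using hvC⟩
  lift x to t.domain using (ht _ x hvt).1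
  have hlim : Tendsto v atTop (𝓝 (t.toFS x)) := by simpa using hvt.tendsto_toFS ht
  have hle : ‖t.toFS x‖ ≤ r :=
    le_of_tendsto' hlim.norm fun n => by simpa using (hvK n).1
  simpa [formENorm_coe, enorm_le_coe, ← NNReal.coe_le_coe] using hle

theorem IsClosed.mem_of_tendsto (ht : t.IsClosed) {u : ℕ → t.domain} {x : H}
    (hu : Tendsto (fun n => (u n : H)) atTop (𝓝 x)) {M : ℝ} (hM : ∀ᶠ n in atTop, t.quad (u n) ≤ M) :
    x ∈ t.domain := by
  obtain ⟨B, hB⟩ := ((hu.norm.pow 2).const_mul (1 - t.bound)).bddAbove_range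
  have hnorm : ∀ᶠ n in atTop, (u n : H) ∈ t.formENorm ⁻¹' Set.Iic (ENNReal.ofReal √(M + B)) := by
    filter_upwards [hM] with n hn
    rw [Set.mem_preimage, formENorm_coe, Set.mem_Iic, ← ofReal_norm]
    refine ENNReal.ofReal_le_ofReal (Real.le_sqrt_of_sq_le ?_)
    rw [norm_toFS_sq]
    exact add_le_add hn (hB ⟨n, rfl⟩)
  have hx := (ht.lowerSemicontinuous_formENorm.isClosed_preimage _).mem_of_tendsto hu hnorm
  exact formENorm_lt_top_iff.1 (lt_of_le_of_lt hx ENNReal.ofReal_lt_top)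

theorem quad_le_formENorm_sq (u : t.domain) :
    t.quad u ≤ (1 + |1 - t.bound|) * (t.formENorm u).toReal ^ 2 := by
  have hnorm : (t.formENorm u).toReal = ‖t.toFS u‖ := by rw [formENorm_coe, toReal_enorm]
  have hsq : ‖(u : H)‖ ^ 2 ≤ ‖t.toFS u‖ ^ 2 :=
    pow_le_pow_left₀ (norm_nonneg _) (t.norm_le_norm_toFS u) 2
  rw [hnorm]
  calc t.quad u = ‖t.toFS u‖ ^ 2 + -(1 - t.bound) * ‖(u : H)‖ ^ 2 := by
        rw [norm_toFS_sq]; ring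
    _ ≤ ‖t.toFS u‖ ^ 2 + |1 - t.bound| * ‖t.toFS u‖ ^ 2 :=
        add_le_add_right (mul_le_mul (neg_le_abs _) hsq (sq_nonneg _) (abs_nonneg _)) _
    _ = (1 + |1 - t.bound|) * ‖t.toFS u‖ ^ 2 := by ring

theorem closure_form (ht : t.IsClosable) (u v : t.domain) :
    (t.closure ht).form (Submodule.inclusion (domain_le_closure ht) u)
      (Submodule.inclusion (domain_le_closure ht) v) = t.form u v :=
  tendsto_nhds_unique (tendsto_closureValue ht
    (x := Submodule.inclusion (domain_le_closure ht) u)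
    (y := Submodule.inclusion (domain_le_closure ht) v) (convergesTo_const u) (convergesTo_const v))
    tendsto_const_nhds

theorem exists_tendsto_formENorm_closure (ht : t.IsClosable) (x : (t.closure ht).domain) :
    ∃ u : ℕ → t.domain, Tendsto (fun n => (u n : H)) atTop (𝓝 x) ∧
      Tendsto (fun n => (t.closure ht).formENorm (u n)) atTop
        (𝓝 ((t.closure ht).formENorm x)) := by
  obtain ⟨u, hu⟩ := x.2
  have hut : (t.closure ht).ConvergesTo
      (fun n => Submodule.inclusion (domain_le_closure ht) (u n)) x :=
    ⟨hu.1, hu.2.congr fun p => by rw [← closure_quad ht, map_sub]⟩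
  refine ⟨u, hu.1, ?_⟩
  rw [formENorm_coe]
  exact (hut.tendsto_toFS (closure_isClosed ht)).enorm.congr fun n => (formENorm_coe _).symm

theorem le_formENorm_closure (ht : t.IsClosable) {g : H → ℝ≥0∞} (hg : LowerSemicontinuous g)
    (hle : ∀ u : t.domain, g u ≤ (t.closure ht).formENorm u) (x : H) :
    g x ≤ (t.closure ht).formENorm x := by
  by_cases hx : x ∈ (t.closure ht).domain
  · obtain ⟨u, hu, hlim⟩ := exists_tendsto_formENorm_closure ht ⟨x, hx⟩
    exact le_of_forall_lt_imp_le_of_dense fun c hc => ge_of_tendsto hlim <|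
      (hu.eventually (hg x c hc)).mono fun n hn => hn.le.trans (hle (u n))
  · simp [formENorm, hx]

/-- The form `s` extends the form `t`. -/
def Extends (s t : SemiboundedForm H) : Prop :=
  ∃ h : t.domain ≤ s.domain, ∀ u v : t.domain,
    s.form (Submodule.inclusion h u) (Submodule.inclusion h v) = t.form u v

theorem Extends.closure {s : SemiboundedForm H} (hst : s.Extends t) (hs : s.IsClosed)
    (ht : t.IsClosable) : s.Extends (t.closure ht) := by
  obtain ⟨h, hform⟩ := hst
  have hconv : ∀ {u : ℕ → t.domain} {x : H}, t.ConvergesTo u x →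
      s.ConvergesTo (fun n => Submodule.inclusion h (u n)) x := fun hu =>
    ⟨hu.1, hu.2.congr fun p => by rw [quad, quad, ← hform, map_sub]⟩
  have hle : (t.closure ht).domain ≤ s.domain := fun x ⟨u, hu⟩ => (hs _ x (hconv hu)).1
  refine ⟨hle, fun x y => ?_⟩
  obtain ⟨u, hu⟩ := x.2
  obtain ⟨v, hv⟩ := y.2
  have hlim := ConvergesTo.tendsto_form_apply hs (x := Submodule.inclusion hle x)
    (y := Submodule.inclusion hle y) (hconv hu) (hconv hv)
  simp only [hform] at hlim
  exact tendsto_nhds_unique hlim (tendsto_closureValue ht hu hv)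

end SemiboundedForm

namespace ClosedForm

variable {H : Type*} [NormedAddCommGroup H] [InnerProductSpace ℂ H]

theorem eq_of_extends {s t : ClosedForm H}
    (h : s.toSemiboundedForm.Extends t.toSemiboundedForm) (hle : s.domain ≤ t.domain) : s = t := by
  obtain ⟨⟨D, F, _, _⟩, _, _⟩ := s
  obtain ⟨⟨D', F', _, _⟩, _, _⟩ := t
  obtain ⟨hle', hform⟩ := h
  obtain rfl : D = D' := le_antisymm hle hle'
  obtain rfl : F = F' := LinearMap.ext₂ hform
  rfl

theorem operator_domain_le (t : ClosedForm H) : t.operator.domain ≤ t.domain :=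
  fun _ hu => hu.1

theorem form_eq_inner_operator (t : ClosedForm H) (v : t.domain) (u : t.operator.domain) :
    t.form v ⟨u, t.operator_domain_le u.2⟩ = inner ℂ (v : H) (t.operator u) :=
  u.2.choose_spec.choose_spec v

theorem le_operator (t : ClosedForm H) {T : H →ₗ.[ℂ] H} (hle : T.domain ≤ t.domain)
    (hform : ∀ (v : t.domain) (u : T.domain), t.form v ⟨u, hle u.2⟩ = inner ℂ (v : H) (T u)) :
    T ≤ t.operator := by
  have hdom : T.domain ≤ t.operator.domain := fun u hu =>
    ⟨hle hu, T ⟨u, hu⟩, fun v => hform v ⟨u, hu⟩⟩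
  refine ⟨hdom, fun u u' huu' => t.operator_unique fun v => ?_⟩
  rw [← hform, ← form_eq_inner_operator]
  congr 1
  exact Subtype.ext huu'

end ClosedForm

section Friedrichs

variable {H : Type*} [NormedAddCommGroup H] [InnerProductSpace ℂ H] {T : H →ₗ.[ℂ] H}
  (hd : Dense (T.domain : Set H)) (hs : T.IsFormalAdjoint T) (hb : IsLowerSemibounded T)

theorem domain_le_friedrichsForm : T.domain ≤ (friedrichsForm T hd hs hb).domain :=
  SemiboundedForm.domain_le_closure (operatorForm_isClosable T hs hb)

theorem friedrichsForm_form (u v : T.domain) :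
    (friedrichsForm T hd hs hb).form ⟨u, domain_le_friedrichsForm hd hs hb u.2⟩
      ⟨v, domain_le_friedrichsForm hd hs hb v.2⟩ = inner ℂ (u : H) (T v) :=
  SemiboundedForm.closure_form (operatorForm_isClosable T hs hb) u v

theorem extends_friedrichsForm {s : SemiboundedForm H} (hcl : s.IsClosed)
    (hle : T.domain ≤ s.domain)
    (hform : ∀ u v : T.domain, s.form ⟨u, hle u.2⟩ ⟨v, hle v.2⟩ = inner ℂ (u : H) (T v)) :
    s.Extends (friedrichsForm T hd hs hb).toSemiboundedForm :=
  SemiboundedForm.Extends.closure ⟨hle, hform⟩ hcl (operatorForm_isClosable T hs hb)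

theorem friedrichsForm_formENorm_map_le {φ : H → H} (hφ : Continuous φ)
    (hnorm : ∀ u, ‖φ u‖ = ‖u‖) (hmaps : ∀ u ∈ T.domain, φ u ∈ T.domain)
    (hquad : ∀ u : T.domain, (inner ℂ (φ u) (T ⟨φ u, hmaps u u.2⟩)).re ≤
      (inner ℂ (u : H) (T u)).re) (x : H) :
    (friedrichsForm T hd hs hb).formENorm (φ x) ≤ (friedrichsForm T hd hs hb).formENorm x := by
  refine SemiboundedForm.le_formENorm_closure (operatorForm_isClosable T hs hb)
    ((friedrichsForm T hd hs hb).closed.lowerSemicontinuous_formENorm.comp hφ)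
    (fun u : T.domain => ?_) x
  let φu : T.domain := ⟨φ u, hmaps u u.2⟩
  refine SemiboundedForm.formENorm_le_formENorm (t := (friedrichsForm T hd hs hb).toSemiboundedForm)
    (u := ⟨φu, domain_le_friedrichsForm hd hs hb φu.2⟩)
    (v := ⟨u, domain_le_friedrichsForm hd hs hb u.2⟩) (hnorm u) ?_
  rw [SemiboundedForm.quad, SemiboundedForm.quad, friedrichsForm_form, friedrichsForm_form]
  exact hquad u

end Friedrichs

/-- A `1`-Lipschitz map of `ℂ` that preserves absolute values. Composition with such a map does
not increase the energy form of a graph and keeps every potential term. -/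
structure ModulusContraction where
  toFun : ℂ → ℂ
  norm_eq : ∀ a, ‖toFun a‖ = ‖a‖
  norm_sub_le : ∀ a b, ‖toFun a - toFun b‖ ≤ ‖a - b‖

theorem norm_le_norm_of_abs_re_im_le {a b : ℂ} (hre : |a.re| ≤ |b.re|) (him : |a.im| ≤ |b.im|) :
    ‖a‖ ≤ ‖b‖ := by
  refine le_of_sq_le_sq ?_ (norm_nonneg _)
  rw [Complex.sq_norm, Complex.sq_norm, Complex.normSq_apply, Complex.normSq_apply]
  exact add_le_add (abs_le_iff_mul_self_le.1 hre) (abs_le_iff_mul_self_le.1 him)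

namespace ModulusContraction

instance : CoeFun ModulusContraction fun _ => ℂ → ℂ := ⟨toFun⟩

section

variable (C : ModulusContraction)

theorem apply_eq_zero {a : ℂ} : C a = 0 ↔ a = 0 := by
  rw [← norm_eq_zero, C.norm_eq, norm_eq_zero]

theorem re_conj_mul_le (a b : ℂ) : (conj a * b).re ≤ (conj (C a) * C b).re := by
  have polarization : ∀ z w : ℂ, 2 * (conj z * w).re = ‖z‖ ^ 2 + ‖w‖ ^ 2 - ‖z - w‖ ^ 2 := by
    intro z w
    simp only [Complex.sq_norm, Complex.normSq_apply, Complex.sub_re, Complex.sub_im,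
      Complex.mul_re, Complex.conj_re, Complex.conj_im]
    ring
  have hsub := pow_le_pow_left₀ (norm_nonneg _) (C.norm_sub_le a b) 2
  have hab := polarization a b
  have hCab := polarization (C a) (C b)
  rw [C.norm_eq, C.norm_eq] at hCab
  linarith

end

/-- The map `a ↦ |Re a| + i |Im a|`. -/
def fold : ModulusContraction where
  toFun a := ⟨|a.re|, |a.im|⟩
  norm_eq _ := le_antisymm (norm_le_norm_of_abs_re_im_le (abs_abs _).le (abs_abs _).le)
    (norm_le_norm_of_abs_re_im_le (abs_abs _).ge (abs_abs _).ge)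
  norm_sub_le _ _ := norm_le_norm_of_abs_re_im_le (abs_abs_sub_abs_le_abs_sub _ _)
    (abs_abs_sub_abs_le_abs_sub _ _)

theorem fold_apply_re (a : ℂ) : (fold a).re = |a.re| := rfl

theorem fold_apply_im (a : ℂ) : (fold a).im = |a.im| := rfl

end ModulusContraction

/-- The point of the segment between `0` and `a` that is closest to `z`. -/
def clampReal (a z : ℝ) : ℝ := max (min a 0) (min z (max a 0))

theorem clampReal_zero (a : ℝ) : clampReal a 0 = 0 := by
  simp [clampReal]

theorem abs_clampReal_le (a z : ℝ) : |clampReal a z| ≤ |a| := by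
  grind [clampReal]

theorem abs_clampReal_sub_le (a z : ℝ) : |clampReal a z - a| ≤ |z - a| := by
  grind [clampReal]

theorem clampReal_eq (a z : ℝ) :
    clampReal a z = (a + |z + (|a| - a) / 2| - |z - (|a| + a) / 2|) / 2 := by
  grind [clampReal]

section WeightedEllTwo

variable {X : Type*} {w : X → ℝ} {hw : ∀ x, 0 ≤ w x} {f g : X → ℂ}

theorem mem_weightedEllTwo_of_norm_le (hg : g ∈ weightedEllTwo w hw) (h : ∀ x, ‖f x‖ ≤ ‖g x‖) :
    f ∈ weightedEllTwo w hw :=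
  Summable.of_nonneg_of_le (fun x => mul_nonneg (hw x) (sq_nonneg _))
    (fun x => mul_le_mul_of_nonneg_left (pow_le_pow_left₀ (norm_nonneg _) (h x) 2) (hw x)) hg

theorem tsum_weighted_le_of_norm_le (hg : g ∈ weightedEllTwo w hw) (h : ∀ x, ‖f x‖ ≤ ‖g x‖) :
    ∑' x, w x * ‖f x‖ ^ 2 ≤ ∑' x, w x * ‖g x‖ ^ 2 :=
  Summable.tsum_le_tsum
    (fun x => mul_le_mul_of_nonneg_left (pow_le_pow_left₀ (norm_nonneg _) (h x) 2) (hw x))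
    (mem_weightedEllTwo_of_norm_le hg h) hg

end WeightedEllTwo

namespace WeightedGraph

variable {X : Type*} {G : WeightedGraph X}

section Contraction

/-- The composition of a function in `ℓ²(X, μ)` with a contraction. -/
def L2.map (C : ModulusContraction) (f : G.L2) : G.L2 :=
  G.mkL2 (fun x => C (f x)) (mem_weightedEllTwo_of_norm_le f.mem fun _ => (C.norm_eq _).le)

theorem L2.map_apply (C : ModulusContraction) (f : G.L2) (x : X) : f.map C x = C (f x) := rfl

theorem L2.norm_le_norm {f g : G.L2} (h : ∀ x, ‖f x‖ ≤ ‖g x‖) : ‖f‖ ≤ ‖g‖ := by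
  refine le_of_sq_le_sq ?_ (norm_nonneg _)
  rw [norm_sq_eq, norm_sq_eq]
  exact tsum_weighted_le_of_norm_le g.mem h

theorem L2.norm_map (C : ModulusContraction) (f : G.L2) : ‖f.map C‖ = ‖f‖ :=
  le_antisymm (L2.norm_le_norm fun _ => (C.norm_eq _).le)
    (L2.norm_le_norm fun _ => (C.norm_eq _).ge)

theorem L2.continuous_map (C : ModulusContraction) : Continuous (L2.map C : G.L2 → G.L2) :=
  (LipschitzWith.of_dist_le' (K := 1) fun f g => by
    rw [one_mul, dist_eq_norm, dist_eq_norm]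
    exact L2.norm_le_norm fun x => C.norm_sub_le (f x) (g x)).continuous

theorem L2.map_mem_finSupp (C : ModulusContraction) {f : G.L2} (hf : f ∈ G.finSupp) :
    f.map C ∈ G.finSupp :=
  Set.Finite.subset hf fun _ hx hfx => hx (C.apply_eq_zero.2 hfx)

end Contraction

section Clamp

/-- The positive parts of the real and imaginary parts of `f`. -/
def L2.posPart (f : G.L2) : G.L2 := (1 / 2 : ℂ) • (f.map .fold + f)

/-- The negative parts of the real and imaginary parts of `f`. -/
def L2.negPart (f : G.L2) : G.L2 := (1 / 2 : ℂ) • (f.map .fold - f)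

/-- The truncation of the real and imaginary parts of `u` to the segments between `0` and the
corresponding parts of `f`, see `clamp_apply`; it is written in terms of `fold` in order that its
form norm can be estimated. -/
def L2.clamp (f u : G.L2) : G.L2 :=
  (1 / 2 : ℂ) • (f + (u + f.negPart).map .fold - (u - f.posPart).map .fold)

theorem L2.clamp_apply (f u : G.L2) (x : X) :
    f.clamp u x = ⟨clampReal (f x).re (u x).re, clampReal (f x).im (u x).im⟩ := by
  have two_inv_mul_re : ∀ a : ℂ, ((1 / 2 : ℂ) * a).re = a.re / 2 := fun a => by
    rw [one_div_mul_eq_div, Complex.div_ofNat_re]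
  have two_inv_mul_im : ∀ a : ℂ, ((1 / 2 : ℂ) * a).im = a.im / 2 := fun a => by
    rw [one_div_mul_eq_div, Complex.div_ofNat_im]
  apply Complex.ext <;>
  simp only [L2.clamp, L2.posPart, L2.negPart, L2.smul_apply, L2.add_apply, L2.sub_apply,
    L2.map_apply, two_inv_mul_re, two_inv_mul_im, Complex.add_re, Complex.add_im, Complex.sub_re,
    Complex.sub_im, ModulusContraction.fold_apply_re, ModulusContraction.fold_apply_im,
    clampReal_eq]

theorem L2.norm_clamp_apply_le (f u : G.L2) (x : X) : ‖f.clamp u x‖ ≤ ‖f x‖ := by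
  rw [clamp_apply]
  exact norm_le_norm_of_abs_re_im_le (abs_clampReal_le _ _) (abs_clampReal_le _ _)

theorem L2.norm_clamp_sub_le (f u : G.L2) : ‖f.clamp u - f‖ ≤ ‖u - f‖ := by
  refine L2.norm_le_norm fun x => ?_
  rw [L2.sub_apply, L2.sub_apply, clamp_apply]
  exact norm_le_norm_of_abs_re_im_le (abs_clampReal_sub_le _ _) (abs_clampReal_sub_le _ _)

theorem L2.clamp_mem_finSupp (f : G.L2) {u : G.L2} (hu : u ∈ G.finSupp) :
    f.clamp u ∈ G.finSupp := by
  refine Set.Finite.subset hu fun x hx hux => hx ?_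
  rw [clamp_apply, show u x = 0 from hux]
  exact Complex.ext (clampReal_zero _) (clampReal_zero _)

end Clamp

section Schrodinger

variable (hFC : G.FinitenessCondition) (V : X → ℝ)

theorem inner_schrodinger_eq_sum (u v : G.finSupp) {s : Finset X}
    (hu : (G.toFun (u : G.L2)).support ⊆ s) (hv : (G.toFun (v : G.L2)).support ⊆ s) :
    inner ℂ (u : G.L2) (schrodinger hFC V v) =
      ∑ x ∈ s, (((∑' y, G.b x y + G.μ x * V x : ℝ) : ℂ) * (conj ((u : G.L2) x) * (v : G.L2) x) -
        ∑ y ∈ s, (G.b y x : ℂ) * (conj ((u : G.L2) x) * (v : G.L2) y)) := by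
  have hu_eq_zero : ∀ x ∉ s, (u : G.L2) x = 0 := fun x hx =>
    Function.notMem_support.1 fun hux => hx (hu hux)
  rw [inner_def, tsum_eq_sum (s := s) fun x hx => by simp [hu_eq_zero x hx]]
  refine Finset.sum_congr rfl fun x _ => ?_
  have hμ : (G.μ x : ℂ) ≠ 0 := Complex.ofReal_ne_zero.2 (G.μ_pos x).ne'
  rw [schrodinger_apply, G.formalSchrodinger_eq V hv]
  simp only [Complex.ofReal_div, Complex.ofReal_add, Complex.ofReal_mul]
  rw [mul_sub, mul_sub, Finset.mul_sum, Finset.mul_sum]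
  congr 1
  · field_simp [hμ]
  · refine Finset.sum_congr rfl fun y _ => ?_
    field_simp [hμ]

theorem finSupp_le_maxMul : G.finSupp ≤ (G.maxMul V).domain := fun _ hu =>
  G.mem_ellTwo_of_finite (Set.Finite.subset hu fun _ hx => right_ne_zero_of_mul hx)

theorem maxMul_apply (u : (G.maxMul V).domain) (x : X) :
    G.maxMul V u x = (V x : ℂ) * (u : G.L2) x := rfl

theorem schrodinger_add_apply (V₁ V₂ : X → ℝ) (u : G.finSupp) :
    schrodinger hFC (V₁ + V₂) u =
      schrodinger hFC V₁ u + G.maxMul V₂ ⟨u, finSupp_le_maxMul V₂ u.2⟩ := by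
  refine L2.ext fun x => ?_
  rw [L2.add_apply, maxMul_apply, schrodinger_apply, schrodinger_apply]
  simp only [formalSchrodinger, Pi.add_apply, Complex.ofReal_add]
  ring

-- The diagonal terms depend only on `|u|`, and the off-diagonal ones enter with the sign `-b ≤ 0`.
theorem re_inner_schrodinger_map_le (C : ModulusContraction) (u : G.finSupp) :
    (inner ℂ ((u : G.L2).map C)
      (schrodinger hFC V ⟨(u : G.L2).map C, L2.map_mem_finSupp C u.2⟩)).re ≤
      (inner ℂ (u : G.L2) (schrodinger hFC V u)).re := by
  have hfin : (G.toFun (u : G.L2)).support.Finite := u.2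
  have hu : (G.toFun (u : G.L2)).support ⊆ hfin.toFinset := hfin.coe_toFinset.ge
  let Cu : G.finSupp := ⟨(u : G.L2).map C, L2.map_mem_finSupp C u.2⟩
  have hCu : (G.toFun (Cu : G.L2)).support ⊆ hfin.toFinset := fun x hx =>
    hu fun hux => hx (C.apply_eq_zero.2 hux)
  change (inner ℂ (Cu : G.L2) (schrodinger hFC V Cu)).re ≤ _
  rw [inner_schrodinger_eq_sum hFC V Cu Cu hCu hCu, inner_schrodinger_eq_sum hFC V u u hu hu]
  simp only [Complex.re_sum, Complex.sub_re, Complex.re_ofReal_mul]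
  refine Finset.sum_le_sum fun x _ => sub_le_sub (le_of_eq ?_) (Finset.sum_le_sum fun y _ =>
    mul_le_mul_of_nonneg_left (C.re_conj_mul_le _ _) (G.b_nonneg _ _))
  have hdiag : conj (C ((u : G.L2) x)) * C ((u : G.L2) x) = conj ((u : G.L2) x) * (u : G.L2) x := by
    rw [Complex.conj_mul', Complex.conj_mul', C.norm_eq]
  exact congrArg (fun a : ℂ => (∑' y, G.b x y + G.μ x * V x) * a.re) hdiag

end Schrodinger

section MulForm

variable (V : X → ℝ) (hV : ∀ x, 0 ≤ V x)

theorem maxMul_domain_le_mulForm : (G.maxMul V).domain ≤ (G.mulForm V hV).domain := by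
  intro u hu
  have hsum : Summable fun x => G.μ x * ‖u x‖ ^ 2 + G.μ x * ‖(V x : ℂ) * u x‖ ^ 2 := u.mem.add hu
  refine Summable.of_nonneg_of_le
    (fun x => mul_nonneg (mul_nonneg (G.μ_pos x).le (hV x)) (sq_nonneg _)) (fun x => ?_) hsum
  have hV_le : V x ≤ 1 + V x ^ 2 := by nlinarith [sq_nonneg (V x - 1), sq_nonneg (V x)]
  calc G.μ x * V x * ‖u x‖ ^ 2 = G.μ x * (V x * ‖u x‖ ^ 2) := mul_assoc _ _ _
    _ ≤ G.μ x * ((1 + V x ^ 2) * ‖u x‖ ^ 2) :=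
        mul_le_mul_of_nonneg_left (mul_le_mul_of_nonneg_right hV_le (sq_nonneg _)) (G.μ_pos x).le
    _ = G.μ x * ‖u x‖ ^ 2 + G.μ x * ‖(V x : ℂ) * u x‖ ^ 2 := by
        rw [norm_mul, Complex.norm_real, Real.norm_eq_abs, mul_pow, sq_abs]
        ring

theorem mulForm_form_eq_inner_maxMul (u : (G.mulForm V hV).domain) (v : (G.maxMul V).domain) :
    (G.mulForm V hV).form u ⟨v, maxMul_domain_le_mulForm V hV v.2⟩ =
      inner ℂ (u : G.L2) (G.maxMul V v) := by
  rw [inner_def]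
  refine tsum_congr fun x => ?_
  rw [maxMul_apply, Complex.ofReal_mul]
  ring

variable {V hV} in
theorem mulForm_quad_le {u v : (G.mulForm V hV).domain}
    (h : ∀ x, ‖(u : G.L2) x‖ ≤ ‖(v : G.L2) x‖) :
    (G.mulForm V hV).quad u ≤ (G.mulForm V hV).quad v := by
  rw [mulForm_quad, mulForm_quad]
  exact tsum_weighted_le_of_norm_le (hw := fun x => mul_nonneg (G.μ_pos x).le (hV x)) v.2 h

open Classical in
/-- The indicator function of `{x}`, as an element of `ℓ²(X, μ)`. -/
def L2.single (G : WeightedGraph X) (x : X) : G.L2 :=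
  G.mkL2 (Pi.single x 1)
    (G.mem_ellTwo_of_finite ((Set.finite_singleton x).subset Pi.support_single_subset))

open Classical in
theorem L2.single_mem_finSupp (x : X) : L2.single G x ∈ G.finSupp :=
  (Set.finite_singleton x).subset (Pi.support_single_subset (a := (1 : ℂ)))

theorem L2.inner_single (x : X) (f : G.L2) : inner ℂ (L2.single G x) f = (G.μ x : ℂ) * f x := by
  rw [inner_def, tsum_eq_single x fun y hy => by simp [single, hy]]
  simp [single]

theorem mulForm_form_single (x : X) (u : (G.mulForm V hV).domain) :
    (G.mulForm V hV).form ⟨L2.single G x, finSupp_le_mulForm V hV (L2.single_mem_finSupp x)⟩ u =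
      (G.μ x : ℂ) * ((V x : ℂ) * (u : G.L2) x) := by
  change ∑' y, ((G.μ y * V y : ℝ) : ℂ) * (conj (L2.single G x y) * (u : G.L2) y) = _
  rw [tsum_eq_single x fun y hy => by simp [L2.single, hy]]
  simp [L2.single, mul_assoc]

theorem closedMulForm_operator_apply (u : (G.closedMulForm V hV).operator.domain) (x : X) :
    (G.closedMulForm V hV).operator u x = (V x : ℂ) * (u : G.L2) x := by
  have hform := (G.closedMulForm V hV).form_eq_inner_operator
    ⟨L2.single G x, finSupp_le_mulForm V hV (L2.single_mem_finSupp x)⟩ u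
  rw [L2.inner_single] at hform
  exact mul_left_cancel₀ (Complex.ofReal_ne_zero.2 (G.μ_pos x).ne')
    (hform.symm.trans (mulForm_form_single V hV x _))

theorem closedMulForm_operator : (G.closedMulForm V hV).operator = G.maxMul V := by
  have hle : G.maxMul V ≤ (G.closedMulForm V hV).operator :=
    (G.closedMulForm V hV).le_operator (maxMul_domain_le_mulForm V hV)
      (mulForm_form_eq_inner_maxMul V hV)
  refine (LinearPMap.eq_of_le_of_domain_eq hle (le_antisymm hle.1 fun u hu => ?_)).symm
  have hVu : (fun x => (V x : ℂ) * u x) = G.toFun ((G.closedMulForm V hV).operator ⟨u, hu⟩) :=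
    funext fun x => (closedMulForm_operator_apply V hV ⟨u, hu⟩ x).symm
  change (fun x => (V x : ℂ) * u x) ∈ G.ellTwo
  exact hVu ▸ L2.mem _

end MulForm

section FormNorm

variable (hFC : G.FinitenessCondition) {V : X → ℝ} (hb : IsLowerSemibounded (schrodinger hFC V))

theorem finSupp_le_schrodingerForm : G.finSupp ≤ (schrodingerForm hFC V hb).domain :=
  domain_le_friedrichsForm G.dense_finSupp (schrodinger_symmetric hFC V) hb

theorem schrodingerForm_formENorm_map_le (C : ModulusContraction) (f : G.L2) :
    (schrodingerForm hFC V hb).formENorm (f.map C) ≤ (schrodingerForm hFC V hb).formENorm f :=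
  friedrichsForm_formENorm_map_le G.dense_finSupp (schrodinger_symmetric hFC V) hb
    (L2.continuous_map C) (L2.norm_map C) (fun _ => L2.map_mem_finSupp C)
    (re_inner_schrodinger_map_le hFC V C) f

theorem schrodingerForm_formENorm_clamp_le (f u : G.L2) :
    (schrodingerForm hFC V hb).formENorm (f.clamp u) ≤
      5 * (schrodingerForm hFC V hb).formENorm f +
        2 * (schrodingerForm hFC V hb).formENorm u := by
  let N := (schrodingerForm hFC V hb).formENorm
  have hfold : ∀ g : G.L2, N (g.map .fold) ≤ N g :=
    schrodingerForm_formENorm_map_le hFC hb .fold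
  have hadd : ∀ g h : G.L2, N (g + h) ≤ N g + N h := SemiboundedForm.formENorm_add_le
  have hsub : ∀ g h : G.L2, N (g - h) ≤ N g + N h := SemiboundedForm.formENorm_sub_le
  have hhalf : ∀ g : G.L2, N ((1 / 2 : ℂ) • g) ≤ N g :=
    SemiboundedForm.formENorm_smul_le (by norm_num)
  have hpos : N f.posPart ≤ N f + N f :=
    (hhalf _).trans ((hadd _ _).trans (add_le_add_left (hfold f) _))
  have hneg : N f.negPart ≤ N f + N f :=
    (hhalf _).trans ((hsub _ _).trans (add_le_add_left (hfold f) _))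
  calc N (f.clamp u)
      ≤ N f + N ((u + f.negPart).map .fold) + N ((u - f.posPart).map .fold) :=
        (hhalf _).trans ((hsub _ _).trans (add_le_add_left (hadd _ _) _))
    _ ≤ N f + (N u + N f.negPart) + (N u + N f.posPart) :=
        add_le_add (add_le_add_right ((hfold _).trans (hadd _ _)) _)
          ((hfold _).trans (hsub _ _))
    _ ≤ N f + (N u + (N f + N f)) + (N u + (N f + N f)) :=
        add_le_add (add_le_add_right (add_le_add_right hneg _) _) (add_le_add_right hpos _)
    _ = 5 * N f + 2 * N u := by ring

end FormNorm

section FormSum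

variable (hFC : G.FinitenessCondition) {V₁ V₂ : X → ℝ} (hV₂ : ∀ x, 0 ≤ V₂ x)
  (hb : IsLowerSemibounded (schrodinger hFC V₁))

theorem add_extends_schrodingerForm :
    ((schrodingerForm hFC V₁ hb).toSemiboundedForm.add (G.mulForm V₂ hV₂)).Extends
      (schrodingerForm hFC (V₁ + V₂)
        (schrodinger_add_lowerSemibounded hFC hV₂ hb)).toSemiboundedForm := by
  refine extends_friedrichsForm G.dense_finSupp (schrodinger_symmetric hFC (V₁ + V₂)) _
    (SemiboundedForm.add_isClosed (schrodingerForm hFC V₁ hb).closed (mulForm_isClosed V₂ hV₂))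
    (le_inf (finSupp_le_schrodingerForm hFC hb) (finSupp_le_mulForm V₂ hV₂))
    fun (u v : G.finSupp) => ?_
  have hV₁ := friedrichsForm_form G.dense_finSupp (schrodinger_symmetric hFC V₁) hb u v
  have hmul := mulForm_form_eq_inner_maxMul (G := G) V₂ hV₂ ⟨u, finSupp_le_mulForm V₂ hV₂ u.2⟩
    ⟨v, finSupp_le_maxMul V₂ v.2⟩
  have hsum := congrArg (inner ℂ (u : G.L2)) (schrodinger_add_apply hFC V₁ V₂ v)
  rw [inner_add_right] at hsum
  exact (congrArg₂ (· + ·) hV₁ hmul).trans hsum.symm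

theorem schrodingerForm_add_quad (u : G.finSupp) :
    (schrodingerForm hFC (V₁ + V₂) (schrodinger_add_lowerSemibounded hFC hV₂ hb)).quad
        ⟨u, finSupp_le_schrodingerForm hFC _ u.2⟩ =
      (schrodingerForm hFC V₁ hb).quad ⟨u, finSupp_le_schrodingerForm hFC hb u.2⟩ +
        (G.mulForm V₂ hV₂).quad ⟨u, finSupp_le_mulForm V₂ hV₂ u.2⟩ := by
  obtain ⟨h, hform⟩ := add_extends_schrodingerForm hFC hV₂ hb
  let u' : (schrodingerForm hFC (V₁ + V₂)
    (schrodinger_add_lowerSemibounded hFC hV₂ hb)).domain :=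
    ⟨u, finSupp_le_schrodingerForm hFC _ u.2⟩
  exact congrArg Complex.re (hform u' u').symm

theorem add_domain_le_schrodingerForm :
    (schrodingerForm hFC V₁ hb).domain ⊓ (G.mulForm V₂ hV₂).domain ≤
      (schrodingerForm hFC (V₁ + V₂)
        (schrodinger_add_lowerSemibounded hFC hV₂ hb)).domain := by
  rintro f ⟨hf₁, hf₂⟩
  let h := schrodingerForm hFC V₁ hb
  have hf_lt_top : h.formENorm f < ∞ := SemiboundedForm.formENorm_lt_top_iff.2 hf₁
  obtain ⟨u, hu, hNu⟩ :=
    SemiboundedForm.exists_tendsto_formENorm_closure (operatorForm_isClosable _ _ hb) ⟨f, hf₁⟩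
  let v : ℕ → G.finSupp := fun n => ⟨f.clamp (u n), L2.clamp_mem_finSupp f (u n).2⟩
  have hv : Tendsto (fun n => (v n : G.L2)) atTop (𝓝 f) :=
    tendsto_iff_norm_sub_tendsto_zero.2 (squeeze_zero (fun _ => norm_nonneg _)
      (fun n => f.norm_clamp_sub_le (u n)) (tendsto_iff_norm_sub_tendsto_zero.1 hu))
  let M : ℝ≥0∞ := 5 * h.formENorm f + 2 * (h.formENorm f + 1)
  have hM : M ≠ ∞ := by finiteness
  have hNv : ∀ᶠ n in atTop, h.formENorm (v n) ≤ M := by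
    filter_upwards [hNu.eventually_le_const
      (ENNReal.lt_add_right hf_lt_top.ne one_ne_zero)] with n hn
    exact (schrodingerForm_formENorm_clamp_le hFC hb f (u n)).trans
      (add_le_add_right (mul_le_mul_right hn 2) _)
  refine (schrodingerForm hFC (V₁ + V₂) _).closed.mem_of_tendsto
    (u := fun n => ⟨v n, finSupp_le_schrodingerForm hFC _ (v n).2⟩)
    (M := (1 + |1 - h.bound|) * M.toReal ^ 2 + (G.mulForm V₂ hV₂).quad ⟨f, hf₂⟩) hv ?_
  filter_upwards [hNv] with n hn
  rw [schrodingerForm_add_quad hFC hV₂ hb]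
  have hquad : h.quad ⟨v n, finSupp_le_schrodingerForm hFC hb (v n).2⟩ ≤
      (1 + |1 - h.bound|) * M.toReal ^ 2 :=
    (SemiboundedForm.quad_le_formENorm_sq _).trans (mul_le_mul_of_nonneg_left
      (pow_le_pow_left₀ ENNReal.toReal_nonneg (ENNReal.toReal_mono hM hn) 2) (by positivity))
  exact add_le_add hquad (mulForm_quad_le (f.norm_clamp_apply_le (u n)))

theorem add_eq_schrodingerForm :
    (schrodingerForm hFC V₁ hb).add (G.closedMulForm V₂ hV₂) (dense_form_domains hFC hb hV₂) =
      schrodingerForm hFC (V₁ + V₂) (schrodinger_add_lowerSemibounded hFC hV₂ hb) :=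
  ClosedForm.eq_of_extends (add_extends_schrodingerForm hFC hV₂ hb)
    (add_domain_le_schrodingerForm hFC hV₂ hb)

end FormSum

end WeightedGraph

end

theorem theorem1_general {X : Type*} (G : WeightedGraph X) (hFC : G.FinitenessCondition)
    (V₁ V₂ : X → ℝ) (hV₂ : ∀ x, 0 ≤ V₂ x)
    (hb : IsLowerSemibounded (WeightedGraph.schrodinger hFC V₁)) :
    (WeightedGraph.schrodingerForm hFC V₁ hb).operator =
        WeightedGraph.schrodingerFriedrichs hFC V₁ hb ∧
      (G.closedMulForm V₂ hV₂).operator = G.maxMul V₂ ∧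
      ClosedForm.formSum (WeightedGraph.schrodingerForm hFC V₁ hb) (G.closedMulForm V₂ hV₂)
          (WeightedGraph.dense_form_domains hFC hb hV₂) =
        WeightedGraph.schrodingerFriedrichs hFC (V₁ + V₂)
          (WeightedGraph.schrodinger_add_lowerSemibounded hFC hV₂ hb) :=
  ⟨rfl, WeightedGraph.closedMulForm_operator V₂ hV₂,
    congrArg ClosedForm.operator (WeightedGraph.add_eq_schrodingerForm hFC hV₂ hb)⟩

theorem theorem1 {X : Type*} [Countable X] [Nonempty X] (G : WeightedGraph X)
    (hconn : G.Connected) (hFC : G.FinitenessCondition) (V₁ V₂ : X → ℝ)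
    (hV₂ : ∀ x, 0 ≤ V₂ x)
    (hb : IsLowerSemibounded (WeightedGraph.schrodinger hFC V₁)) :
    -- the closed forms that enter the form-sum are those of `L_{V₁}` and of `M_{V₂}`
    (WeightedGraph.schrodingerForm hFC V₁ hb).operator =
        WeightedGraph.schrodingerFriedrichs hFC V₁ hb ∧
      (G.closedMulForm V₂ hV₂).operator = G.maxMul V₂ ∧
    -- the form-sum of `L_{V₁}` and `M_{V₂}` is the Friedrichs extension for `V₁ + V₂`
      ClosedForm.formSum (WeightedGraph.schrodingerForm hFC V₁ hb) (G.closedMulForm V₂ hV₂)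
          (WeightedGraph.dense_form_domains hFC hb hV₂) =
        WeightedGraph.schrodingerFriedrichs hFC (V₁ + V₂)
          (WeightedGraph.schrodinger_add_lowerSemibounded hFC hV₂ hb) :=
  theorem1_general G hFC V₁ V₂ hV₂ hb
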